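/- Let $X,Y$ be (real or complex) Banach spaces and assume that $Y$ is continuously embedded into $X$. Let $T>0$, set $J=(0,T)$, and let $s\in(1,\infty)$. For $\theta\in(0,1)$ and $q\in[1,\infty)$ let $(X,Y)_{\theta,q}$ be the real interpolation space of all $x\in X$ for which \[ \|x\|_{(X,Y)_{\theta,q}} = \Bigl(\int_0^\infty \bigl(t^{-\theta}K(t,x)\bigr)^q\,\frac{dt}{t}\Bigr)^{1/q} <\infty , \qquad K(t,x)=\inf_{y\in Y}\bigl(\|x-y\|_X+t\|y\|_Y\bigr). \] Let $W^{1,s}(J;X)$ be the space of all $u\in L^s(J;X)$ with weak derivative $u'\in L^s(J;X)$, with norm equivalent to $\|u\|_{L^s(J;X)}+\|u'\|_{L^s(J;X)}$, and let $W^{1,s}(J;X)\cap L^s(J;Y)$ carry a norm equivalent to $\|u\|_{W^{1,s}(J;X)}+\|u\|_{L^s(J;Y)}$. For a normed space $Z$ let $C(\overline J;Z)$ carry the supremum norm, and for $\beta\in(0,1)$ let $C^\beta(J;Z)$ be the space of bounded $\beta$-Hölder continuous functions $f\colon J\to Z$ with norm $\sup_{t\in J}\|f(t)\|_Z+\sup_{t_1\neq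 t_2}\|f(t_1)-f(t_2)\|_Z/|t_1-t_2|^\beta$. Below, $\hookrightarrow$ denotes a continuous injective linear map that sends each $u$ to a function equal to $u$ almost everywhere on $J$. Then the following hold. (a) $W^{1,s}(J;X)\cap L^s(J;Y)\hookrightarrow C\bigl(\overline J;(X,Y)_{1-\frac1s,s}\bigr)$. (b) If $\theta\in(0,1-\frac1s)$ and $\beta=1-\frac1s-\theta$, then $W^{1,s}(J;X)\cap L^s(J;Y)\hookrightarrow C^\beta\bigl(J;(X,Y)_{\theta,1}\bigr)$. -/

import Mathlib

open Set MeasureTheory Filter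
open scoped ENNReal NNReal ContDiff BoundedContinuousFunction

instance factOneLeOfReal (s : ℝ) [hs : Fact (1 < s)] : Fact (1 ≤ ENNReal.ofReal s) :=
  ⟨ENNReal.one_le_ofReal.2 hs.out.le⟩

section RealInterpolation

variable {𝕜 X Y : Type*} [RCLike 𝕜] [NormedAddCommGroup X] [NormedSpace 𝕜 X]
  [NormedAddCommGroup Y] [NormedSpace 𝕜 Y]

/-- The K-functional `K(t, x; X, Y) = inf { ‖x₀‖_X + t ‖x₁‖_Y : x = x₀ + x₁ }` of the couple
`(X, Y)`, where `Y` is regarded as a subspace of `X` through `ι`. It is used for `t > 0` only. -/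
noncomputable def kFunctional (ι : Y →L[𝕜] X) (t : ℝ) (x : X) : ℝ :=
  ⨅ y : Y, (‖x - ι y‖ + t * ‖y‖)

/-- The measure `dt / t` on `(0, ∞)`. -/
noncomputable def dtOverT : Measure ℝ :=
  (volume.restrict (Ioi (0 : ℝ))).withDensity fun t => ENNReal.ofReal t⁻¹

/-- The norm of the real interpolation space `(X, Y)_{θ, q}` given by the K-method, with value
`∞` outside of the space: the norm of `t ↦ t ^ (-θ) * K(t, x)` in `L^q((0, ∞), dt / t)`. -/
noncomputable def realInterpENorm (ι : Y →L[𝕜] X) (θ : ℝ) (q : ℝ≥0∞) (x : X) : ℝ≥0∞ :=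
  eLpNorm (fun t => t ^ (-θ) * kFunctional ι t x) q dtOverT

theorem kFunctional_bddBelow (ι : Y →L[𝕜] X) {t : ℝ} (ht : 0 ≤ t) (x : X) :
    BddBelow (range fun y : Y => ‖x - ι y‖ + t * ‖y‖) :=
  ⟨0, by rintro _ ⟨y, rfl⟩; positivity⟩

theorem kFunctional_nonneg (ι : Y →L[𝕜] X) {t : ℝ} (ht : 0 ≤ t) (x : X) :
    0 ≤ kFunctional ι t x :=
  Real.iInf_nonneg fun y => by positivity

theorem kFunctional_le (ι : Y →L[𝕜] X) {t : ℝ} (ht : 0 ≤ t) (x : X) (y : Y) :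
    kFunctional ι t x ≤ ‖x - ι y‖ + t * ‖y‖ :=
  ciInf_le (kFunctional_bddBelow ι ht x) y

theorem kFunctional_add_le (ι : Y →L[𝕜] X) {t : ℝ} (ht : 0 ≤ t) (x x' : X) :
    kFunctional ι t (x + x') ≤ kFunctional ι t x + kFunctional ι t x' := by
  refine le_ciInf_add_ciInf fun y y' => (kFunctional_le ι ht _ (y + y')).trans ?_
  have h1 : ‖x + x' - ι (y + y')‖ ≤ ‖x - ι y‖ + ‖x' - ι y'‖ := by
    rw [map_add, add_sub_add_comm]; exact norm_add_le _ _
  have h2 : t * ‖y + y'‖ ≤ t * (‖y‖ + ‖y'‖) := by gcongr; exact norm_add_le _ _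
  linarith

theorem kFunctional_smul_le (ι : Y →L[𝕜] X) {t : ℝ} (ht : 0 ≤ t) (c : 𝕜) (x : X) :
    kFunctional ι t (c • x) ≤ ‖c‖ * kFunctional ι t x := by
  rw [kFunctional, kFunctional, Real.mul_iInf_of_nonneg (norm_nonneg c)]
  refine le_ciInf fun y => (kFunctional_le ι ht _ (c • y)).trans (le_of_eq ?_)
  rw [map_smul, ← smul_sub, norm_smul, norm_smul]
  ring

theorem kFunctional_smul (ι : Y →L[𝕜] X) {t : ℝ} (ht : 0 ≤ t) (c : 𝕜) (x : X) :
    kFunctional ι t (c • x) = ‖c‖ * kFunctional ι t x := by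
  refine le_antisymm (kFunctional_smul_le ι ht c x) ?_
  rcases eq_or_ne c 0 with rfl | hc
  · simpa using kFunctional_nonneg ι ht (0 : X)
  · have h := kFunctional_smul_le ι ht c⁻¹ (c • x)
    rw [inv_smul_smul₀ hc, norm_inv] at h
    have hc' : 0 < ‖c‖ := norm_pos_iff.2 hc
    rwa [le_inv_mul_iff₀ hc'] at h

theorem eq_zero_of_kFunctional_eq_zero (ι : Y →L[𝕜] X) {t : ℝ} (ht : 0 < t) {x : X}
    (hx : kFunctional ι t x = 0) : x = 0 := by
  have hM : 0 < 1 + ‖ι‖ / t := by positivity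
  have h : ‖x‖ / (1 + ‖ι‖ / t) ≤ kFunctional ι t x := by
    refine le_ciInf fun y => ?_
    rw [div_le_iff₀ hM]
    have h1 : ‖x‖ ≤ ‖x - ι y‖ + ‖ι y‖ := by simpa using norm_add_le (x - ι y) (ι y)
    have h2 := ι.le_opNorm y
    have h3 : (‖x - ι y‖ + t * ‖y‖) * (1 + ‖ι‖ / t) =
        ‖x - ι y‖ + ‖ι‖ * ‖y‖ + (t * ‖y‖ + ‖x - ι y‖ * (‖ι‖ / t)) := by
      field_simp; ring
    have h4 : 0 ≤ t * ‖y‖ + ‖x - ι y‖ * (‖ι‖ / t) := by positivity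
    linarith
  rw [hx, div_le_iff₀ hM, zero_mul] at h
  exact norm_le_zero_iff.1 h

theorem dtOverT_absolutelyContinuous : dtOverT ≪ volume.restrict (Ioi (0 : ℝ)) :=
  withDensity_absolutelyContinuous _ _

theorem ae_dtOverT_pos : ∀ᵐ t ∂dtOverT, 0 < t :=
  dtOverT_absolutelyContinuous.ae_le (ae_restrict_mem measurableSet_Ioi)

theorem dtOverT_ne_zero : dtOverT ≠ 0 := by
  intro h
  rw [dtOverT, withDensity_eq_zero_iff (by fun_prop)] at h
  have h2 : ∀ᵐ _ ∂volume.restrict (Ioi (0 : ℝ)), False := by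
    filter_upwards [h, ae_restrict_mem measurableSet_Ioi] with t h1 ht
    simp only [Pi.zero_apply, ENNReal.ofReal_eq_zero, inv_nonpos] at h1
    exact absurd (mem_Ioi.1 ht) (not_lt.2 h1)
  have h3 : volume.restrict (Ioi (0 : ℝ)) = 0 := ae_eq_bot.1 (eventually_false_iff_eq_bot.1 h2)
  rw [Measure.restrict_eq_zero, Real.volume_Ioi] at h3
  exact ENNReal.top_ne_zero h3

theorem aestronglyMeasurable_kFunctional (ι : Y →L[𝕜] X) (θ : ℝ) (x : X) :
    AEStronglyMeasurable (fun t => t ^ (-θ) * kFunctional ι t x) dtOverT := by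
  refine AEStronglyMeasurable.mono_ac dtOverT_absolutelyContinuous ?_
  have h : MonotoneOn (fun t => kFunctional ι t x) (Ioi 0) := fun t ht t' _ htt' =>
    ciInf_mono (kFunctional_bddBelow ι (le_of_lt ht) x) fun y => by gcongr
  exact ((measurable_id.pow_const (-θ)).aemeasurable.mul
    (aemeasurable_restrict_of_monotoneOn measurableSet_Ioi h)).aestronglyMeasurable

theorem realInterpENorm_add_le (ι : Y →L[𝕜] X) (θ : ℝ) (q : ℝ≥0∞) [hq : Fact (1 ≤ q)]
    (x x' : X) :
    realInterpENorm ι θ q (x + x') ≤ realInterpENorm ι θ q x + realInterpENorm ι θ q x' := by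
  refine le_trans ?_ (eLpNorm_add_le (aestronglyMeasurable_kFunctional ι θ x)
    (aestronglyMeasurable_kFunctional ι θ x') hq.out)
  refine eLpNorm_mono_ae ?_
  filter_upwards [ae_dtOverT_pos] with t ht
  have h0 : 0 ≤ t ^ (-θ) := Real.rpow_nonneg ht.le _
  have h1 := kFunctional_nonneg ι ht.le (x + x')
  have h2 := kFunctional_add_le ι ht.le x x'
  rw [Pi.add_apply, ← mul_add, norm_mul, norm_mul]
  gcongr
  rw [Real.norm_of_nonneg h1]
  exact h2.trans (le_abs_self _)

theorem realInterpENorm_smul (ι : Y →L[𝕜] X) (θ : ℝ) (q : ℝ≥0∞) (c : 𝕜) (x : X) :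
    realInterpENorm ι θ q (c • x) = ‖c‖ₑ * realInterpENorm ι θ q x := by
  have h : (fun t => t ^ (-θ) * kFunctional ι t (c • x)) =ᵐ[dtOverT]
      ‖c‖ • fun t => t ^ (-θ) * kFunctional ι t x := by
    filter_upwards [ae_dtOverT_pos] with t ht
    rw [kFunctional_smul ι ht.le, Pi.smul_apply, smul_eq_mul]
    ring
  rw [realInterpENorm, eLpNorm_congr_ae h, eLpNorm_const_smul, enorm_norm, realInterpENorm]

theorem eq_zero_of_realInterpENorm_eq_zero (ι : Y →L[𝕜] X) (θ : ℝ) (q : ℝ≥0∞)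
    [hq : Fact (1 ≤ q)] {x : X} (hx : realInterpENorm ι θ q x = 0) : x = 0 := by
  have hq0 : q ≠ 0 := (zero_lt_one.trans_le hq.out).ne'
  have h := (eLpNorm_eq_zero_iff (aestronglyMeasurable_kFunctional ι θ x) hq0).1 hx
  have : NeZero dtOverT := ⟨dtOverT_ne_zero⟩
  obtain ⟨t, ht0, ht⟩ := (h.and ae_dtOverT_pos).exists
  have h0 : t ^ (-θ) ≠ 0 := (Real.rpow_pos_of_pos ht _).ne'
  exact eq_zero_of_kFunctional_eq_zero ι ht ((mul_eq_zero.1 ht0).resolve_left h0)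

/-- The elements of the real interpolation space `(X, Y)_{θ, q}`, as a subspace of `X`. -/
def realInterpSubmodule (ι : Y →L[𝕜] X) (θ : ℝ) (q : ℝ≥0∞) [Fact (1 ≤ q)] :
    Submodule 𝕜 X where
  carrier := {x | realInterpENorm ι θ q x < ⊤}
  zero_mem' := by
    have h := realInterpENorm_smul ι θ q (0 : 𝕜) 0
    simp only [zero_smul, enorm_zero, zero_mul] at h
    simp [h]
  add_mem' ha hb := (realInterpENorm_add_le ι θ q _ _).trans_lt (ENNReal.add_lt_top.2 ⟨ha, hb⟩)
  smul_mem' c x hx := by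
    rw [mem_ofPred_eq, realInterpENorm_smul]
    exact ENNReal.mul_lt_top enorm_lt_top hx

/-- The real interpolation space `(X, Y)_{θ, q}`, with its own norm (not the norm of `X`). -/
def RealInterp (ι : Y →L[𝕜] X) (θ : ℝ) (q : ℝ≥0∞) [Fact (1 ≤ q)] : Type _ :=
  realInterpSubmodule ι θ q

namespace RealInterp

variable (ι : Y →L[𝕜] X) (θ : ℝ) (q : ℝ≥0∞) [Fact (1 ≤ q)]

instance : AddCommGroup (RealInterp ι θ q) :=
  inferInstanceAs (AddCommGroup (realInterpSubmodule ι θ q))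

instance : Module 𝕜 (RealInterp ι θ q) :=
  inferInstanceAs (Module 𝕜 (realInterpSubmodule ι θ q))

/-- The inclusion of `(X, Y)_{θ, q}` into `X`. -/
def incl : RealInterp ι θ q →ₗ[𝕜] X := (realInterpSubmodule ι θ q).subtype

noncomputable instance : Norm (RealInterp ι θ q) :=
  ⟨fun x => (realInterpENorm ι θ q (incl ι θ q x)).toReal⟩

theorem norm_def (x : RealInterp ι θ q) :
    ‖x‖ = (realInterpENorm ι θ q (incl ι θ q x)).toReal := rfl

theorem incl_injective : Function.Injective (incl ι θ q) := Subtype.val_injective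

theorem enorm_incl_lt_top (x : RealInterp ι θ q) :
    realInterpENorm ι θ q (incl ι θ q x) < ⊤ := x.2

theorem normCore : NormedSpace.Core 𝕜 (RealInterp ι θ q) where
  norm_nonneg _ := ENNReal.toReal_nonneg
  norm_smul c x := by
    rw [norm_def, norm_def, map_smul, realInterpENorm_smul, ENNReal.toReal_mul, toReal_enorm]
  norm_triangle x y := by
    have hx := (enorm_incl_lt_top ι θ q x).ne
    have hy := (enorm_incl_lt_top ι θ q y).ne
    rw [norm_def, norm_def, norm_def, map_add, ← ENNReal.toReal_add hx hy]
    exact ENNReal.toReal_mono (ENNReal.add_ne_top.2 ⟨hx, hy⟩) (realInterpENorm_add_le ι θ q _ _)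
  norm_eq_zero_iff x := by
    constructor
    · intro h
      rw [norm_def, ENNReal.toReal_eq_zero_iff] at h
      have h0 := h.resolve_right (enorm_incl_lt_top ι θ q x).ne
      exact incl_injective ι θ q
        ((eq_zero_of_realInterpENorm_eq_zero ι θ q h0).trans (map_zero _).symm)
    · rintro rfl
      have h := realInterpENorm_smul ι θ q (0 : 𝕜) 0
      simp only [zero_smul, enorm_zero, zero_mul] at h
      rw [norm_def, map_zero, h, ENNReal.toReal_zero]

noncomputable instance : NormedAddCommGroup (RealInterp ι θ q) :=
  NormedAddCommGroup.ofCore (normCore ι θ q)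

noncomputable instance : NormedSpace 𝕜 (RealInterp ι θ q) :=
  NormedSpace.ofCore (normCore ι θ q)

end RealInterp

end RealInterpolation

section Hoelder

variable (𝕜 : Type*) [RCLike 𝕜] (A : Type*) [MetricSpace A] (β : ℝ≥0)
  (Z : Type*) [NormedAddCommGroup Z] [NormedSpace 𝕜 Z]

/-- The bounded continuous functions `A → Z` that are Hölder continuous of exponent `β`. -/
def hoelderSubmodule : Submodule 𝕜 (A →ᵇ Z) where
  carrier := {f | MemHolder β (f : A → Z)}
  zero_mem' := memHolder_zero
  add_mem' hf hg := hf.add hg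
  smul_mem' _ _ hf := hf.smul

/-- The space `C^β(A; Z)` of bounded Hölder continuous functions of exponent `β`, normed by the
sum of the supremum norm and the Hölder seminorm. -/
def HoelderSpace : Type _ := hoelderSubmodule 𝕜 A β Z

namespace HoelderSpace

noncomputable instance : AddCommGroup (HoelderSpace 𝕜 A β Z) :=
  inferInstanceAs (AddCommGroup (hoelderSubmodule 𝕜 A β Z))

noncomputable instance : Module 𝕜 (HoelderSpace 𝕜 A β Z) :=
  inferInstanceAs (Module 𝕜 (hoelderSubmodule 𝕜 A β Z))

/-- The inclusion of `C^β(A; Z)` into the bounded continuous functions. -/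
noncomputable def toBCF : HoelderSpace 𝕜 A β Z →ₗ[𝕜] (A →ᵇ Z) := (hoelderSubmodule 𝕜 A β Z).subtype

noncomputable instance : Norm (HoelderSpace 𝕜 A β Z) :=
  ⟨fun f => ‖toBCF 𝕜 A β Z f‖ + nnHolderNorm β (toBCF 𝕜 A β Z f : A → Z)⟩

theorem norm_def (f : HoelderSpace 𝕜 A β Z) :
    ‖f‖ = ‖toBCF 𝕜 A β Z f‖ + nnHolderNorm β (toBCF 𝕜 A β Z f : A → Z) := rfl

theorem toBCF_injective : Function.Injective (toBCF 𝕜 A β Z) := Subtype.val_injective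

theorem memHolder (f : HoelderSpace 𝕜 A β Z) : MemHolder β (toBCF 𝕜 A β Z f : A → Z) := f.2

theorem normCore : NormedSpace.Core 𝕜 (HoelderSpace 𝕜 A β Z) where
  norm_nonneg f := by rw [norm_def]; positivity
  norm_smul c f := by
    rw [norm_def, norm_def, map_smul, norm_smul, BoundedContinuousFunction.coe_smul]
    have h := (memHolder 𝕜 A β Z f).nnHolderNorm_smul c
    have h' : nnHolderNorm β (fun x => c • toBCF 𝕜 A β Z f x) =
        ‖c‖₊ * nnHolderNorm β (toBCF 𝕜 A β Z f : A → Z) := h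
    rw [h', NNReal.coe_mul, coe_nnnorm, mul_add]
  norm_triangle f g := by
    rw [norm_def, norm_def, norm_def, map_add, BoundedContinuousFunction.coe_add]
    have h : (nnHolderNorm β ((toBCF 𝕜 A β Z f : A → Z) + (toBCF 𝕜 A β Z g : A → Z)) : ℝ) ≤
        nnHolderNorm β (toBCF 𝕜 A β Z f : A → Z) + nnHolderNorm β (toBCF 𝕜 A β Z g : A → Z) := by
      exact_mod_cast (memHolder 𝕜 A β Z f).nnHolderNorm_add_le (memHolder 𝕜 A β Z g)
    have h' := norm_add_le (toBCF 𝕜 A β Z f) (toBCF 𝕜 A β Z g)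
    linarith
  norm_eq_zero_iff f := by
    constructor
    · intro h
      rw [norm_def] at h
      have h1 : ‖toBCF 𝕜 A β Z f‖ = 0 :=
        le_antisymm (by linarith [(nnHolderNorm β (toBCF 𝕜 A β Z f : A → Z)).coe_nonneg])
          (norm_nonneg _)
      exact toBCF_injective 𝕜 A β Z ((norm_eq_zero.1 h1).trans (map_zero _).symm)
    · rintro rfl
      rw [norm_def, map_zero, norm_zero, BoundedContinuousFunction.coe_zero, nnHolderNorm_zero]
      simp

noncomputable instance : NormedAddCommGroup (HoelderSpace 𝕜 A β Z) :=
  NormedAddCommGroup.ofCore (normCore 𝕜 A β Z)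

noncomputable instance : NormedSpace 𝕜 (HoelderSpace 𝕜 A β Z) :=
  NormedSpace.ofCore (normCore 𝕜 A β Z)

end HoelderSpace

end Hoelder

section Sobolev

/-- Lebesgue measure on the interval `J = (0, T)`. -/
noncomputable abbrev volJ (T : ℝ) : Measure ℝ := volume.restrict (Ioo 0 T)

/-- `v` is the weak derivative of `u` on `(0, T)`. -/
def IsWeakDeriv {X : Type*} [NormedAddCommGroup X] [NormedSpace ℝ X] (T : ℝ) (u v : ℝ → X) :
    Prop :=
  ∀ φ : ℝ → ℝ, ContDiff ℝ ∞ φ → HasCompactSupport φ → tsupport φ ⊆ Ioo 0 T →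
    ∫ t, deriv φ t • u t ∂volJ T = -∫ t, φ t • v t ∂volJ T

theorem integrable_testFunction_smul {X : Type*} [NormedAddCommGroup X] [NormedSpace ℝ X]
    {T : ℝ} {p : ℝ≥0∞} [hp : Fact (1 ≤ p)] {φ : ℝ → ℝ} (hφ : Continuous φ)
    (hc : HasCompactSupport φ) (u : Lp X p (volJ T)) :
    Integrable (fun t => φ t • u t) (volJ T) := by
  obtain ⟨C, hC⟩ := hc.exists_bound_of_continuous hφ
  exact ((Lp.memLp u).integrable hp.out).bdd_smul C hφ.aestronglyMeasurable (.of_forall hC)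

variable (𝕜 : Type*) {X Y : Type*} [RCLike 𝕜] [NormedAddCommGroup X] [NormedSpace 𝕜 X]
  [NormedAddCommGroup Y] [NormedSpace 𝕜 Y]

/-- The Sobolev space `W^{1,p}(J; X)`, `J = (0, T)`: the functions `u ∈ L^p(J; X)` with a weak
derivative `u' ∈ L^p(J; X)`. An element is the pair `(u, u')`, and `u` determines `u'`;
the norm is `max ‖u‖_{L^p(J; X)} ‖u'‖_{L^p(J; X)}`. -/
def SobolevW1 (X : Type*) [NormedAddCommGroup X] [NormedSpace 𝕜 X] [NormedSpace ℝ X]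
    [IsScalarTower ℝ 𝕜 X] (p : ℝ≥0∞) [Fact (1 ≤ p)] (T : ℝ) :
    Submodule 𝕜 (Lp X p (volJ T) × Lp X p (volJ T)) where
  carrier := {w | IsWeakDeriv T w.1 w.2}
  zero_mem' := by
    intro φ _ _ _
    have h : ∀ ψ : ℝ → ℝ, ∫ t, ψ t • (0 : Lp X p (volJ T)) t ∂volJ T = 0 := by
      intro ψ
      refine integral_eq_zero_of_ae ?_
      filter_upwards [Lp.coeFn_zero X p (volJ T)] with t ht
      rw [ht, Pi.zero_apply, smul_zero]
    simp only [Prod.fst_zero, Prod.snd_zero, h, neg_zero]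
  add_mem' := by
    rintro ⟨u, u'⟩ ⟨v, v'⟩ hu hv φ h1 h2 h3
    have h : ∀ ψ : ℝ → ℝ, Continuous ψ → HasCompactSupport ψ → ∀ f g : Lp X p (volJ T),
        ∫ t, ψ t • (f + g) t ∂volJ T = ∫ t, ψ t • f t ∂volJ T + ∫ t, ψ t • g t ∂volJ T := by
      intro ψ hψ hc f g
      rw [← integral_add (integrable_testFunction_smul hψ hc f)
        (integrable_testFunction_smul hψ hc g)]
      refine integral_congr_ae ?_
      filter_upwards [Lp.coeFn_add f g] with t ht
      rw [ht, Pi.add_apply, smul_add]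
    have hu' := hu φ h1 h2 h3
    have hv' := hv φ h1 h2 h3
    simp only [Prod.mk_add_mk] at hu' hv' ⊢
    rw [h _ (h1.continuous_deriv (by simp)) h2.deriv, h _ h1.continuous h2, hu', hv', neg_add]
  smul_mem' := by
    rintro c ⟨u, u'⟩ hu φ h1 h2 h3
    have h : ∀ (ψ : ℝ → ℝ) (f : Lp X p (volJ T)),
        ∫ t, ψ t • (c • f : Lp X p (volJ T)) t ∂volJ T = c • ∫ t, ψ t • f t ∂volJ T := by
      intro ψ f
      have : SMulCommClass ℝ 𝕜 X := IsScalarTower.to_smulCommClass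
      rw [← integral_smul]
      refine integral_congr_ae ?_
      filter_upwards [Lp.coeFn_smul c f] with t ht
      rw [ht, Pi.smul_apply, smul_comm]
    have hu' := hu φ h1 h2 h3
    simp only [Prod.smul_mk] at hu' ⊢
    rw [h, h, hu', smul_neg]

variable {𝕜} [NormedSpace ℝ X] [IsScalarTower ℝ 𝕜 X]

/-- The space `W^{1,p}(J; X) ∩ L^p(J; Y)`, `J = (0, T)`, where `Y` is regarded as a subspace of `X`
through `ι`: the pairs of some `u ∈ W^{1,p}(J; X)` and some `w ∈ L^p(J; Y)` that are the same
function, normed by `max ‖u‖_{W^{1,p}(J; X)} ‖w‖_{L^p(J; Y)}`. -/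
def MaxRegSpace (ι : Y →L[𝕜] X) (p : ℝ≥0∞) [Fact (1 ≤ p)] (T : ℝ) :
    Submodule 𝕜 (SobolevW1 𝕜 X p T × Lp Y p (volJ T)) where
  carrier := {w | ι.compLpₗ p (volJ T) w.2 = w.1.1.1}
  zero_mem' := map_zero _
  add_mem' {v w} hv hw := by
    simp only [mem_ofPred_eq] at hv hw
    simp [hv, hw, -ContinuousLinearMap.compLpₗ_apply]
  smul_mem' c w hw := by
    simp only [mem_ofPred_eq] at hw
    simp [hw, -ContinuousLinearMap.compLpₗ_apply]

/-- An element of `W^{1,p}(J; X) ∩ L^p(J; Y)` as a (class of) function(s) with values in `X`. -/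
def MaxRegSpace.toLp {ι : Y →L[𝕜] X} {p : ℝ≥0∞} [Fact (1 ≤ p)] {T : ℝ}
    (u : MaxRegSpace ι p T) : Lp X p (volJ T) := u.1.1.1.1

end Sobolev

/-! Write θ₀ = 1 - 1/s and g = ‖u'‖_X + ‖u‖_Y on J, extended by zero, so that g lies in L^s.
Everything rests on one pointwise bound: for t in the closed interval and 0 < h ≤ T, K(h, u(t)) ≤ ∫
g over (t - h, t + h). To see it, let y be the mean of u over the part of this window inside J.
Since u is a primitive of u', the distance ‖u(t) - y‖_X is at most the integral of ‖u'‖_X over that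
part. Since the part has length at least h, h‖y‖_Y is at most the integral of ‖u‖_Y over it
(`kFunctional_le_of_primitive`, `IsRep.kFunctional_le`).

Interpolation norms are split at some ε > 0 (`realInterpENorm_le_below_add`). Above ε only ‖x‖_X
enters, because K(t, x) ≤ ‖x‖_X. Also, u is θ₀-Hölder continuous with values in X, by Hölder's
inequality applied to u'.

For (a), the part of the norm below ε is the L^s norm of K(h, u(t))/h for dh on (0, ε). By Hardy's
inequality (`lintegral_hardy`) it is at most a constant times the L^s norm of g on [t - ε, t + ε].
This bounds the trace norm, and absolute continuity of the integral of g^s makes it small uniformly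
in t as ε → 0. For fixed ε, the remaining part of the norm of u(t) - u(t') is controlled by ‖u(t) -
u(t')‖_X, which gives continuity.

For (b), Hölder's inequality turns the pointwise bound into K(h, u(t)) ≤ C‖u‖h^θ₀. With the cut at d
= |t - t'|, the part below d integrates to a multiple of d^(θ₀ - θ), and the part above is at most a
multiple of d^θ₀ d^(-θ). -/

/-! ### Functions with integrable weak derivative are primitives -/

section WeakDerivative

variable {X : Type*} [NormedAddCommGroup X] [NormedSpace ℝ X] {T : ℝ}

theorem integrable_smul_of_hasCompactSupport {φ : ℝ → ℝ} (hφ : Continuous φ)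
    (hc : HasCompactSupport φ) {u : ℝ → X} (hu : Integrable u (volJ T)) :
    Integrable (fun t => φ t • u t) (volJ T) := by
  obtain ⟨C, hC⟩ := hc.exists_bound_of_continuous hφ
  exact hu.bdd_smul C hφ.aestronglyMeasurable (.of_forall hC)

theorem IsWeakDeriv.sub {u u' v v' : ℝ → X} (hu : Integrable u (volJ T))
    (hu' : Integrable u' (volJ T)) (hv : Integrable v (volJ T)) (hv' : Integrable v' (volJ T))
    (h : IsWeakDeriv T u v) (h' : IsWeakDeriv T u' v') : IsWeakDeriv T (u - u') (v - v') := by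
  intro φ h1 h2 h3
  have hd : Continuous (deriv φ) := h1.continuous_deriv (by simp)
  simp only [Pi.sub_apply, smul_sub]
  rw [integral_sub (integrable_smul_of_hasCompactSupport hd h2.deriv hu)
      (integrable_smul_of_hasCompactSupport hd h2.deriv hu'),
    integral_sub (integrable_smul_of_hasCompactSupport h1.continuous h2 hv)
      (integrable_smul_of_hasCompactSupport h1.continuous h2 hv'), h φ h1 h2 h3, h' φ h1 h2 h3]
  abel

/-- The integral over `(0, T)` of a function vanishing off `(0, T)`. -/
theorem integral_volJ_eq_of_tsupport_subset {φ : ℝ → ℝ} (h : tsupport φ ⊆ Ioo 0 T) :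
    ∫ t, φ t ∂volJ T = ∫ t, φ t :=
  setIntegral_eq_integral_of_forall_compl_eq_zero fun t ht => by
    by_contra h0
    exact ht (h (subset_tsupport _ h0))

/-- The weak derivative of a primitive of an integrable function is that function. -/
theorem isWeakDeriv_primitive [CompleteSpace X] {v : ℝ → X} (hv : Integrable v (volJ T)) :
    IsWeakDeriv T (fun t => ∫ r in (0 : ℝ)..t, v r) v := by
  intro φ h1 h2 h3
  have hd : Continuous (deriv φ) := h1.continuous_deriv (by simp)
  have hdi : Integrable (deriv φ) (volJ T) :=
    (hd.integrable_of_hasCompactSupport h2.deriv).restrict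
  have hm : MeasurableSet {p : ℝ × ℝ | p.2 ≤ p.1} := measurableSet_le measurable_snd measurable_fst
  -- Fubini on the triangle r ≤ t: for fixed r, integrating φ' over [r, T) leaves -φ(r), because
  -- φ(T) = 0.
  have hi : Integrable (Function.uncurry fun t r =>
      {p : ℝ × ℝ | p.2 ≤ p.1}.indicator (fun p => deriv φ p.1 • v p.2) (t, r))
      ((volJ T).prod (volJ T)) := (hdi.smul_prod hv).indicator hm
  have hL : ∫ t, deriv φ t • (∫ r in (0 : ℝ)..t, v r) ∂volJ T = ∫ t, ∫ r,
      {p : ℝ × ℝ | p.2 ≤ p.1}.indicator (fun p => deriv φ p.1 • v p.2) (t, r) ∂volJ T ∂volJ T := by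
    refine integral_congr_ae ?_
    filter_upwards [ae_restrict_mem measurableSet_Ioo] with t ht
    have : (fun r => {p : ℝ × ℝ | p.2 ≤ p.1}.indicator (fun p => deriv φ p.1 • v p.2) (t, r)) =
        (Iic t).indicator fun r => deriv φ t • v r := by
      ext r
      simp [indicator]
    rw [this, integral_indicator measurableSet_Iic, Measure.restrict_restrict measurableSet_Iic,
      integral_smul, intervalIntegral.integral_of_le ht.1.le]
    congr 3
    ext r
    simp only [mem_inter_iff, mem_Iic, mem_Ioo, mem_Ioc]
    exact ⟨fun h => ⟨h.2, h.1, h.2.trans_lt ht.2⟩, fun h => ⟨h.2.1, h.1⟩⟩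
  beta_reduce
  rw [hL, integral_integral_swap hi, ← integral_neg]
  refine integral_congr_ae ?_
  filter_upwards [ae_restrict_mem measurableSet_Ioo] with r hr
  have : (fun t => {p : ℝ × ℝ | p.2 ≤ p.1}.indicator (fun p => deriv φ p.1 • v p.2) (t, r)) =
      (Ici r).indicator fun t => deriv φ t • v r := by
    ext t
    simp [indicator]
  have hT : φ T = 0 := by
    by_contra h0
    exact lt_irrefl _ (h3 (subset_tsupport _ h0)).2
  rw [this, integral_indicator measurableSet_Ici, Measure.restrict_restrict measurableSet_Ici,
    integral_smul_const, ← neg_smul]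
  congr 1
  have hs : Ici r ∩ Ioo 0 T = Ico r T := by
    ext t
    simp only [mem_inter_iff, mem_Ici, mem_Ioo, mem_Ico]
    exact ⟨fun h => ⟨h.1, h.2.2⟩, fun h => ⟨h.1, hr.1.trans_le h.1, h.2⟩⟩
  rw [hs, integral_Ico_eq_integral_Ioc, ← intervalIntegral.integral_of_le hr.2.le,
    intervalIntegral.integral_deriv_eq_sub
      (fun t _ => (h1.differentiable (by simp)).differentiableAt) (hd.intervalIntegrable _ _), hT]
  simp

/-- A test function with vanishing integral is the derivative of a test function. -/
theorem exists_testFunction_deriv_eq {η : ℝ → ℝ} (h1 : ContDiff ℝ ∞ η)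
    (h2 : HasCompactSupport η) (h3 : tsupport η ⊆ Ioo 0 T) (h0 : ∫ t, η t = 0) :
    ∃ φ : ℝ → ℝ, ContDiff ℝ ∞ φ ∧ HasCompactSupport φ ∧ tsupport φ ⊆ Ioo 0 T ∧ deriv φ = η := by
  -- For η = 0 the endpoints a and b below would be default values, so this case is separate.
  rcases (tsupport η).eq_empty_or_nonempty with he | hne
  · refine ⟨0, contDiff_const, HasCompactSupport.zero, by simp [tsupport], ?_⟩
    rw [tsupport_eq_empty_iff.1 he]
    exact deriv_const' 0
  have ha := h2.isCompact.sInf_mem hne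
  have hb := h2.isCompact.sSup_mem hne
  set a := sInf (tsupport η)
  set b := sSup (tsupport η)
  have hab : ∀ t, η t ≠ 0 → t ∈ Icc a b := fun t ht =>
    ⟨csInf_le h2.isCompact.bddBelow (subset_tsupport _ ht),
      le_csSup h2.isCompact.bddAbove (subset_tsupport _ ht)⟩
  have hder : ∀ t, HasDerivAt (fun t => ∫ r in (0 : ℝ)..t, η r) (η t) t := fun t =>
    h1.continuous.integral_hasStrictDerivAt 0 t |>.hasDerivAt
  have hd : deriv (fun t => ∫ r in (0 : ℝ)..t, η r) = η := funext fun t => (hder t).deriv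
  -- The primitive vanishes to the left of a because η does and 0 < a, and to the right of b because
  -- the total integral of η is zero.
  have hsupp : ∀ t ∉ Icc a b, ∫ r in (0 : ℝ)..t, η r = 0 := by
    intro t ht
    rcases lt_or_ge t a with hta | hta
    · refine intervalIntegral.integral_zero_ae (.of_forall fun r hr => ?_)
      by_contra hr0
      have := (hab r hr0).1
      have hr' := (mem_uIoc.1 hr)
      have := (h3 ha).1
      rcases hr' with h | h <;> linarith [h.1, h.2]
    · have htb : b < t := lt_of_not_ge fun h => ht ⟨hta, h⟩
      have h0t : 0 ≤ t := ((h3 hb).1.trans htb).le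
      rw [intervalIntegral.integral_of_le h0t]
      refine (setIntegral_eq_integral_of_forall_compl_eq_zero fun r hr => ?_).trans h0
      by_contra hr0
      have := hab r hr0
      exact hr ⟨(h3 ha).1.trans_le this.1, this.2.trans htb.le⟩
  have hts : tsupport (fun t => ∫ r in (0 : ℝ)..t, η r) ⊆ Icc a b :=
    closure_minimal (fun t ht => by_contra fun h => ht (hsupp t h)) isClosed_Icc
  refine ⟨_, ?_, HasCompactSupport.of_support_subset_isCompact isCompact_Icc
    ((subset_tsupport _).trans hts), hts.trans (Icc_subset_Ioo (h3 ha).1 (h3 hb).2), hd⟩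
  rw [contDiff_infty_iff_deriv, hd]
  exact ⟨fun t => (hder t).differentiableAt, h1⟩

theorem exists_testFunction_integral_eq_one (hT : 0 < T) :
    ∃ ψ : ℝ → ℝ, ContDiff ℝ ∞ ψ ∧ HasCompactSupport ψ ∧ tsupport ψ ⊆ Ioo 0 T ∧ ∫ t, ψ t = 1 := by
  let f : ContDiffBump (T / 2) := ⟨T / 8, T / 4, by positivity, by linarith⟩
  refine ⟨f.normed volume, f.contDiff_normed, f.hasCompactSupport_normed, ?_, f.integral_normed⟩
  rw [f.tsupport_normed_eq, Real.closedBall_eq_Icc]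
  exact Icc_subset_Ioo (by simp only [f]; linarith) (by simp only [f]; linarith)

theorem ae_eq_zero_of_integral_testFunction_smul [CompleteSpace X] {u : ℝ → X}
    (hu : Integrable u (volJ T))
    (h : ∀ η : ℝ → ℝ, ContDiff ℝ ∞ η → HasCompactSupport η → tsupport η ⊆ Ioo 0 T →
      ∫ t, η t • u t ∂volJ T = 0) : u =ᵐ[volJ T] 0 := by
  refine (ae_restrict_iff' measurableSet_Ioo).2 ?_
  refine isOpen_Ioo.ae_eq_zero_of_integral_contDiff_smul_eq_zero
    (IntegrableOn.locallyIntegrableOn hu) fun η h1 h2 h3 => ?_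
  rw [← h η h1 h2 h3]
  refine (setIntegral_eq_integral_of_forall_compl_eq_zero fun t ht => ?_).symm
  have : η t = 0 := by_contra fun h0 => ht (h3 (subset_tsupport _ h0))
  rw [this, zero_smul]

/-- A function with vanishing weak derivative is constant. -/
theorem IsWeakDeriv.exists_ae_eq_const [CompleteSpace X] (hT : 0 < T) {u : ℝ → X}
    (hu : Integrable u (volJ T)) (h : IsWeakDeriv T u 0) : ∃ c : X, u =ᵐ[volJ T] fun _ => c := by
  obtain ⟨ψ, p1, p2, p3, p4⟩ := exists_testFunction_integral_eq_one hT
  refine ⟨∫ t, ψ t • u t ∂volJ T, ?_⟩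
  set c := ∫ t, ψ t • u t ∂volJ T with hc
  have hz := ae_eq_zero_of_integral_testFunction_smul (u := fun t => u t - c)
    (hu.sub (integrable_const c)) fun η h1 h2 h3 => ?_
  · filter_upwards [hz] with t ht
    exact sub_eq_zero.1 ht
  -- The function η - mψ has integral zero, hence is the derivative of a test function, and u
  -- integrates to zero against it. So ∫ ηu = mc, which is ∫ ηc.
  set m := ∫ t, η t with hm
  have hηi := h1.continuous.integrable_of_hasCompactSupport h2 (μ := volume)
  have hψi := p1.continuous.integrable_of_hasCompactSupport p2 (μ := volume)
  have ht : tsupport (fun t => η t - m * ψ t) ⊆ Ioo 0 T :=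
    (tsupport_sub η (fun t => m * ψ t)).trans
      (union_subset h3 ((tsupport_mul_subset_right).trans p3))
  obtain ⟨φ, f1, f2, f3, f4⟩ := exists_testFunction_deriv_eq (T := T)
    (η := fun t => η t - m * ψ t) (h1.sub (contDiff_const.mul p1)) (h2.sub (p2.mul_left))
    ht (by rw [integral_sub hηi (hψi.const_mul m), integral_const_mul, p4, ← hm]; ring)
  have hw := h φ f1 f2 f3
  simp only [f4, Pi.zero_apply, smul_zero, integral_zero, neg_zero, sub_smul, mul_smul] at hw
  have i1 := integrable_smul_of_hasCompactSupport h1.continuous h2 hu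
  have i2 := integrable_smul_of_hasCompactSupport p1.continuous p2 hu
  rw [integral_sub i1 (i2.fun_smul m), integral_smul, ← hc] at hw
  simp only [smul_sub]
  rw [integral_sub i1 (integrable_smul_of_hasCompactSupport h1.continuous h2 (integrable_const c)),
    integral_smul_const, integral_volJ_eq_of_tsupport_subset h3]
  exact hw

/-- A function with integrable weak derivative is, up to a constant, a primitive of it. -/
theorem IsWeakDeriv.exists_ae_eq_add_primitive [CompleteSpace X] (hT : 0 < T) {u v : ℝ → X}
    (hu : Integrable u (volJ T)) (hv : Integrable v (volJ T)) (h : IsWeakDeriv T u v) :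
    ∃ c : X, u =ᵐ[volJ T] fun t => c + ∫ r in (0 : ℝ)..t, v r := by
  have hvI : IntegrableOn v (Icc 0 T) := by
    rwa [integrableOn_Icc_iff_integrableOn_Ioo]
  have hcont : ContinuousOn (fun t => ∫ r in (0 : ℝ)..t, v r) (Icc 0 T) := by
    have := intervalIntegral.continuousOn_primitive_interval (μ := volume) (f := v)
      (a := 0) (b := T) (by rwa [uIcc_of_le hT.le])
    rwa [uIcc_of_le hT.le] at this
  have hp : Integrable (fun t => ∫ r in (0 : ℝ)..t, v r) (volJ T) :=
    (hcont.integrableOn_Icc).mono_set Ioo_subset_Icc_self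
  have hd := IsWeakDeriv.sub hu hp hv hv h (isWeakDeriv_primitive hv)
  rw [sub_self] at hd
  obtain ⟨c, hc⟩ := hd.exists_ae_eq_const hT (hu.sub hp)
  refine ⟨c, ?_⟩
  filter_upwards [hc] with t ht
  rw [Pi.sub_apply] at ht
  rw [← ht, sub_add_cancel]

end WeakDerivative

/-! ### Hardy's inequality -/

section Hardy

theorem lintegral_Ioc_rpow_sub_one {c : ℝ} (hc : 0 < c) {h : ℝ} (hh : 0 ≤ h) :
    ∫⁻ r in Ioc 0 h, ENNReal.ofReal (r ^ (c - 1)) = ENNReal.ofReal (h ^ c / c) := by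
  have hi : IntervalIntegrable (fun r : ℝ => r ^ (c - 1)) volume 0 h :=
    intervalIntegral.intervalIntegrable_rpow' (by linarith)
  rw [← ofReal_integral_eq_lintegral_ofReal ((intervalIntegrable_iff_integrableOn_Ioc_of_le hh).1 hi)
    ((ae_restrict_iff' measurableSet_Ioc).2 (.of_forall fun r hr => Real.rpow_nonneg hr.1.le _)),
    ← intervalIntegral.integral_of_le hh, integral_rpow (Or.inl (by linarith)), sub_add_cancel,
    Real.zero_rpow hc.ne', sub_zero]

theorem lintegral_Ioi_rpow_neg_sub_one {c : ℝ} (hc : 0 < c) {h : ℝ} (hh : 0 < h) :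
    ∫⁻ r in Ioi h, ENNReal.ofReal (r ^ (-c - 1)) = ENNReal.ofReal (h ^ (-c) / c) := by
  rw [← ofReal_integral_eq_lintegral_ofReal
    (integrableOn_Ioi_rpow_of_lt (a := -c - 1) (by linarith) hh)
    ((ae_restrict_iff' measurableSet_Ioi).2
      (.of_forall fun r hr => Real.rpow_nonneg (hh.trans hr).le _)),
    integral_Ioi_rpow_of_lt (by linarith) hh, sub_add_cancel, neg_div_neg_eq]

/-- Hölder's inequality for f r^(b/s) times r^(-b/s), with b = 1 - 1/s. The conjugate exponent is
1/b, so the second factor contributes ∫ r^(b-1) = h^b/b, which is finite, while the remaining power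
h^(-b-1) is integrable at infinity. The latter allows a subsequent integration in h. -/
theorem rpow_lintegral_Ioc_le {s : ℝ} (hs : 1 < s) {f : ℝ → ℝ≥0∞} (hf : Measurable f) {h : ℝ}
    (hh : 0 < h) :
    (ENNReal.ofReal h⁻¹ * ∫⁻ r in Ioc 0 h, f r) ^ s ≤
      ENNReal.ofReal ((1 - 1 / s)⁻¹ ^ (s - 1)) *
        ∫⁻ r in Ioc 0 h, f r ^ s * ENNReal.ofReal (r ^ (1 - 1 / s)) *
          ENNReal.ofReal (h ^ (-(1 - 1 / s) - 1)) := by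
  have hs0 : 0 < s := by linarith
  set b := 1 - 1 / s with hb
  have hb0 : 0 < b := by rw [hb, sub_pos, div_lt_one hs0]; exact hs
  have hsb : s * b = s - 1 := by rw [hb]; field_simp
  have hpq : s.HolderConjugate b⁻¹ := by
    refine (Real.holderConjugate_iff).2 ⟨hs, ?_⟩
    rw [inv_inv, hb]; simp
  have hH := ENNReal.lintegral_mul_le_Lp_mul_Lq (volume.restrict (Ioc 0 h)) hpq
    (f := fun r => f r * ENNReal.ofReal (r ^ (b / s))) (g := fun r => ENNReal.ofReal (r ^ (-(b / s))))
    (by fun_prop) (by fun_prop)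
  have e1 : ∫⁻ r in Ioc 0 h, ((fun r => f r * ENNReal.ofReal (r ^ (b / s))) *
      fun r => ENNReal.ofReal (r ^ (-(b / s)))) r = ∫⁻ r in Ioc 0 h, f r := by
    refine setLIntegral_congr_fun measurableSet_Ioc fun r hr => ?_
    simp only [Pi.mul_apply]
    rw [mul_assoc, ← ENNReal.ofReal_mul (Real.rpow_nonneg hr.1.le _), ← Real.rpow_add hr.1]
    simp
  have e2 : ∫⁻ r in Ioc 0 h, (f r * ENNReal.ofReal (r ^ (b / s))) ^ s =
      ∫⁻ r in Ioc 0 h, f r ^ s * ENNReal.ofReal (r ^ b) := by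
    refine setLIntegral_congr_fun measurableSet_Ioc fun r hr => ?_
    rw [ENNReal.mul_rpow_of_nonneg _ _ hs0.le,
      ENNReal.ofReal_rpow_of_nonneg (Real.rpow_nonneg hr.1.le _) hs0.le, ← Real.rpow_mul hr.1.le,
      div_mul_cancel₀ _ hs0.ne']
  have e3 : ∫⁻ r in Ioc 0 h, ENNReal.ofReal (r ^ (-(b / s))) ^ b⁻¹ =
      ENNReal.ofReal (h ^ b / b) := by
    rw [← lintegral_Ioc_rpow_sub_one hb0 hh.le]
    refine setLIntegral_congr_fun measurableSet_Ioc fun r hr => ?_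
    rw [ENNReal.ofReal_rpow_of_nonneg (Real.rpow_nonneg hr.1.le _) (by positivity),
      ← Real.rpow_mul hr.1.le]
    congr 2
    rw [hb]; field_simp
    have : s - 1 ≠ 0 := by linarith
    field_simp
    ring
  rw [e1, e2, e3] at hH
  have hm : Measurable fun r => f r ^ s * ENNReal.ofReal (r ^ b) := by fun_prop
  rw [lintegral_mul_const _ hm]
  calc _ ≤ (ENNReal.ofReal h⁻¹ * ((∫⁻ r in Ioc 0 h, f r ^ s * ENNReal.ofReal (r ^ b)) ^ (1 / s) *
        ENNReal.ofReal (h ^ b / b) ^ (1 / b⁻¹))) ^ s := by gcongr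
    _ = _ := by
      rw [ENNReal.mul_rpow_of_nonneg _ _ hs0.le, ENNReal.mul_rpow_of_nonneg _ _ hs0.le,
        ← ENNReal.rpow_mul, ← ENNReal.rpow_mul, one_div_mul_cancel hs0.ne', ENNReal.rpow_one,
        ENNReal.ofReal_rpow_of_nonneg (by positivity) hs0.le,
        ENNReal.ofReal_rpow_of_nonneg (by positivity) (by positivity)]
      rw [mul_left_comm, mul_left_comm (ENNReal.ofReal _) _ (ENNReal.ofReal _),
        ← ENNReal.ofReal_mul (by positivity), ← ENNReal.ofReal_mul (by positivity)]
      congr 2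
      rw [one_div, inv_inv, mul_comm b s, hsb, div_eq_mul_inv,
        Real.mul_rpow (by positivity) (by positivity), mul_left_comm, ← Real.rpow_mul hh.le,
        Real.inv_rpow hh.le, ← Real.rpow_neg hh.le, ← mul_assoc, ← Real.rpow_add hh, mul_comm]
      congr 2
      rw [hb]; field_simp; ring

/-- **Hardy's inequality.** -/
theorem lintegral_hardy {s : ℝ} (hs : 1 < s) {f : ℝ → ℝ≥0∞} (hf : Measurable f) :
    ∫⁻ h in Ioi 0, (ENNReal.ofReal h⁻¹ * ∫⁻ r in Ioc 0 h, f r) ^ s ≤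
      ENNReal.ofReal ((1 - 1 / s)⁻¹ ^ s) * ∫⁻ r in Ioi 0, f r ^ s := by
  have hs0 : 0 < s := by linarith
  set b := 1 - 1 / s with hb
  have hb0 : 0 < b := by rw [hb, sub_pos, div_lt_one hs0]; exact hs
  have hm : MeasurableSet {p : ℝ × ℝ | p.2 ≤ p.1} := measurableSet_le measurable_snd measurable_fst
  let F : ℝ × ℝ → ℝ≥0∞ := {p : ℝ × ℝ | p.2 ≤ p.1}.indicator fun p =>
    f p.2 ^ s * ENNReal.ofReal (p.2 ^ b) * ENNReal.ofReal (p.1 ^ (-b - 1))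
  have hF : Measurable F := by
    refine Measurable.indicator ?_ hm
    fun_prop
  calc _ ≤ ∫⁻ h in Ioi 0, ENNReal.ofReal (b⁻¹ ^ (s - 1)) * ∫⁻ r in Ioi 0, F (h, r) := by
        refine setLIntegral_mono' measurableSet_Ioi fun h hh => ?_
        refine (rpow_lintegral_Ioc_le hs hf hh).trans (le_of_eq ?_)
        congr 1
        have : (fun r => F (h, r)) = (Iic h).indicator fun r =>
            f r ^ s * ENNReal.ofReal (r ^ b) * ENNReal.ofReal (h ^ (-b - 1)) := by
          ext r; simp [F, indicator]
        rw [this, lintegral_indicator measurableSet_Iic,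
          Measure.restrict_restrict measurableSet_Iic, Iic_inter_Ioi]
    _ = ENNReal.ofReal (b⁻¹ ^ (s - 1)) * ∫⁻ r in Ioi 0, ∫⁻ h in Ioi 0, F (h, r) := by
        rw [lintegral_const_mul _ hF.lintegral_prod_right',
          lintegral_lintegral_swap (f := fun h r => F (h, r)) hF.aemeasurable]
    -- After the exchange, h ranges over [r, ∞), and the integral r^(-b)/b of h^(-b-1) cancels the
    -- weight r^b.
    _ = ENNReal.ofReal (b⁻¹ ^ (s - 1)) * ∫⁻ r in Ioi 0, f r ^ s * ENNReal.ofReal b⁻¹ := by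
        congr 1
        refine setLIntegral_congr_fun measurableSet_Ioi fun r hr => ?_
        have hr : 0 < r := hr
        have : (fun h => F (h, r)) = (Ici r).indicator fun h =>
            f r ^ s * ENNReal.ofReal (r ^ b) * ENNReal.ofReal (h ^ (-b - 1)) := by
          ext h; simp [F, indicator]
        have hI : Ici r ∩ Ioi 0 = Ici r := inter_eq_left.2 fun x hx => lt_of_lt_of_le hr hx
        rw [this, lintegral_indicator measurableSet_Ici,
          Measure.restrict_restrict measurableSet_Ici, hI, setLIntegral_congr Ioi_ae_eq_Ici.symm,
          lintegral_const_mul _ (by fun_prop), lintegral_Ioi_rpow_neg_sub_one hb0 hr, mul_assoc,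
          ← ENNReal.ofReal_mul (by positivity), Real.rpow_neg hr.le]
        congr 2
        field_simp
    _ = _ := by
        rw [lintegral_mul_const _ (by fun_prop), mul_left_comm, mul_comm,
          ← ENNReal.ofReal_mul (by positivity)]
        congr 2
        rw [Real.rpow_sub_one (by positivity)]
        field_simp

end Hardy

/-! ### Interpolation norms cut at a level ε -/

section RealInterpolation

variable {𝕜 X Y : Type*} [RCLike 𝕜] [NormedAddCommGroup X] [NormedSpace 𝕜 X]
  [NormedAddCommGroup Y] [NormedSpace 𝕜 Y]

theorem setLIntegral_dtOverT {S : Set ℝ} (hS : MeasurableSet S) (F : ℝ → ℝ≥0∞) :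
    ∫⁻ t in S, F t ∂dtOverT = ∫⁻ t in S ∩ Ioi 0, ENNReal.ofReal t⁻¹ * F t := by
  rw [dtOverT, restrict_withDensity hS, Measure.restrict_restrict hS,
    lintegral_withDensity_eq_lintegral_mul_non_measurable _ (by fun_prop)
      (.of_forall fun _ => ENNReal.ofReal_lt_top)]
  rfl

theorem kFunctional_le_norm (ι : Y →L[𝕜] X) {t : ℝ} (ht : 0 ≤ t) (x : X) :
    kFunctional ι t x ≤ ‖x‖ := by
  simpa using kFunctional_le ι ht x 0

/-- The part of the norm of `(X, Y)_{θ, q}` that only sees `K(t, x)` for `t ≤ ε`. -/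
noncomputable def realInterpENormBelow (ι : Y →L[𝕜] X) (θ : ℝ) (q : ℝ≥0∞) (ε : ℝ) (x : X) :
    ℝ≥0∞ :=
  eLpNorm (fun t => t ^ (-θ) * kFunctional ι t x) q (dtOverT.restrict (Iic ε))

theorem realInterpENormBelow_sub_le (ι : Y →L[𝕜] X) (θ : ℝ) (q : ℝ≥0∞) [hq : Fact (1 ≤ q)]
    (ε : ℝ) (x x' : X) :
    realInterpENormBelow ι θ q ε (x - x') ≤
      realInterpENormBelow ι θ q ε x + realInterpENormBelow ι θ q ε x' := by
  refine le_trans ?_ (eLpNorm_add_le (aestronglyMeasurable_kFunctional ι θ x).restrict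
    (aestronglyMeasurable_kFunctional ι θ x').restrict hq.out)
  refine eLpNorm_mono_ae ?_
  filter_upwards [ae_restrict_of_ae ae_dtOverT_pos] with t ht
  have h0 : 0 ≤ t ^ (-θ) := Real.rpow_nonneg ht.le _
  have h1 := kFunctional_nonneg ι ht.le (x - x')
  have h2 := kFunctional_add_le ι ht.le x (-x')
  have h3 : kFunctional ι t (-x') = kFunctional ι t x' := by
    simpa using kFunctional_smul ι ht.le (-1 : 𝕜) x'
  rw [Pi.add_apply, ← mul_add, norm_mul, norm_mul]
  gcongr
  rw [Real.norm_of_nonneg h1, sub_eq_add_neg]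
  exact (h2.trans_eq (by rw [h3])).trans (le_abs_self _)

/-- Above ε the choice y = 0 in the K-functional is good enough: the weight t^(-θ) has finite norm
there for θ > 0 and finite q, so large t costs only the norm of X. -/
theorem realInterpENorm_le_below_add (ι : Y →L[𝕜] X) (θ : ℝ) (q : ℝ≥0∞) [hq : Fact (1 ≤ q)]
    {ε : ℝ} (hε : 0 < ε) (x : X) :
    realInterpENorm ι θ q x ≤ realInterpENormBelow ι θ q ε x +
      ‖x‖ₑ * eLpNorm (fun t : ℝ => t ^ (-θ)) q (dtOverT.restrict (Ioi ε)) := by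
  set f : ℝ → ℝ := fun t => t ^ (-θ) * kFunctional ι t x with hf
  have hfm := aestronglyMeasurable_kFunctional ι θ x
  have h1 : (Iic ε).indicator f + (Ioi ε).indicator f = f := by
    rw [← compl_Iic]; exact indicator_self_add_compl _ _
  have h2 : eLpNorm f q (dtOverT.restrict (Ioi ε)) ≤
      ‖x‖ₑ * eLpNorm (fun t : ℝ => t ^ (-θ)) q (dtOverT.restrict (Ioi ε)) := by
    rw [← enorm_norm x, ← eLpNorm_const_smul]
    refine eLpNorm_mono_ae ?_
    filter_upwards [ae_restrict_mem measurableSet_Ioi] with t ht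
    have ht0 : 0 < t := hε.trans ht
    rw [Pi.smul_apply, smul_eq_mul, norm_mul, norm_mul, mul_comm, norm_norm,
      Real.norm_of_nonneg (kFunctional_nonneg ι ht0.le x)]
    gcongr
    exact kFunctional_le_norm ι ht0.le x
  calc realInterpENorm ι θ q x = eLpNorm ((Iic ε).indicator f + (Ioi ε).indicator f) q dtOverT := by
        rw [h1]; rfl
    _ ≤ _ := eLpNorm_add_le (hfm.indicator measurableSet_Iic) (hfm.indicator measurableSet_Ioi)
        hq.out
    _ ≤ _ := by
        rw [eLpNorm_indicator_eq_eLpNorm_restrict measurableSet_Iic,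
          eLpNorm_indicator_eq_eLpNorm_restrict measurableSet_Ioi]
        exact add_le_add le_rfl h2

theorem lintegral_dtOverT_rpow_neg {c : ℝ} (hc : 0 < c) {ε : ℝ} (hε : 0 < ε) :
    ∫⁻ t in Ioi ε, ENNReal.ofReal (t ^ (-c)) ∂dtOverT = ENNReal.ofReal (ε ^ (-c) / c) := by
  rw [setLIntegral_dtOverT measurableSet_Ioi, ← lintegral_Ioi_rpow_neg_sub_one hc hε,
    inter_eq_left.2 (Ioi_subset_Ioi hε.le)]
  refine setLIntegral_congr_fun measurableSet_Ioi fun t ht => ?_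
  have ht : 0 < t := hε.trans ht
  rw [← ENNReal.ofReal_mul (by positivity), Real.rpow_sub_one ht.ne', div_eq_inv_mul]

theorem eLpNorm_rpow_neg_Ioi_lt_top {θ : ℝ} (hθ : 0 < θ) {s : ℝ} (hs : 0 < s) {ε : ℝ}
    (hε : 0 < ε) :
    eLpNorm (fun t : ℝ => t ^ (-θ)) (ENNReal.ofReal s) (dtOverT.restrict (Ioi ε)) < ⊤ := by
  rw [eLpNorm_lt_top_iff_lintegral_rpow_enorm_lt_top (by simpa using hs) ENNReal.ofReal_ne_top,
    ENNReal.toReal_ofReal hs.le]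
  have : ∫⁻ t in Ioi ε, ‖t ^ (-θ)‖ₑ ^ s ∂dtOverT =
      ∫⁻ t in Ioi ε, ENNReal.ofReal (t ^ (-(θ * s))) ∂dtOverT := by
    refine setLIntegral_congr_fun measurableSet_Ioi fun t ht => ?_
    have ht : 0 < t := hε.trans ht
    rw [Real.enorm_of_nonneg (by positivity), ENNReal.ofReal_rpow_of_nonneg (by positivity) hs.le,
      ← Real.rpow_mul ht.le, neg_mul]
  rw [this, lintegral_dtOverT_rpow_neg (mul_pos hθ hs) hε]
  exact ENNReal.ofReal_lt_top

theorem eLpNorm_one_rpow_neg_Ioi {θ : ℝ} (hθ : 0 < θ) {ε : ℝ} (hε : 0 < ε) :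
    eLpNorm (fun t : ℝ => t ^ (-θ)) 1 (dtOverT.restrict (Ioi ε)) = ENNReal.ofReal (ε ^ (-θ) / θ) := by
  rw [eLpNorm_one_eq_lintegral_enorm, ← lintegral_dtOverT_rpow_neg hθ hε]
  refine setLIntegral_congr_fun measurableSet_Ioi fun t ht => ?_
  have ht : 0 < t := hε.trans ht
  exact Real.enorm_of_nonneg (by positivity)

/-- For θ = 1 - 1/s the exponents combine to -θs - 1 = -s. The s-th power of the norm is therefore
the integral of (K(t, x)/t)^s dt, and K(t, x)/t is at most the mean of f over (0, t], to which
Hardy's inequality applies. -/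
theorem realInterpENormBelow_le_of_kFunctional_le_lintegral (ι : Y →L[𝕜] X) {s : ℝ} (hs : 1 < s)
    {ε : ℝ} {x : X} {f : ℝ → ℝ≥0∞} (hf : Measurable f)
    (h : ∀ t ∈ Ioc 0 ε, ENNReal.ofReal (kFunctional ι t x) ≤ ∫⁻ r in Ioc 0 t, f r) :
    realInterpENormBelow ι (1 - 1 / s) (ENNReal.ofReal s) ε x ≤
      ENNReal.ofReal (1 - 1 / s)⁻¹ * (∫⁻ r in Ioc 0 ε, f r ^ s) ^ (1 / s) := by
  have hs0 : 0 < s := by linarith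
  have hb0 : 0 < 1 - 1 / s := by rw [sub_pos, div_lt_one hs0]; exact hs
  rw [realInterpENormBelow, eLpNorm_eq_lintegral_rpow_enorm_toReal (by simpa using hs0)
    ENNReal.ofReal_ne_top, ENNReal.toReal_ofReal hs0.le, setLIntegral_dtOverT measurableSet_Iic,
    Iic_inter_Ioi]
  have hR : ENNReal.ofReal (1 - 1 / s)⁻¹ * (∫⁻ r in Ioc 0 ε, f r ^ s) ^ (1 / s) =
      (ENNReal.ofReal ((1 - 1 / s)⁻¹ ^ s) * ∫⁻ r in Ioc 0 ε, f r ^ s) ^ (1 / s) := by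
    rw [ENNReal.mul_rpow_of_nonneg _ _ (by positivity),
      ENNReal.ofReal_rpow_of_nonneg (by positivity) (by positivity), ← Real.rpow_mul (by positivity),
      mul_one_div_cancel hs0.ne', Real.rpow_one]
  rw [hR]
  gcongr
  -- Cutting f off beyond ε keeps the right side local; for t ≤ ε the means do not change.
  have hI : ∫⁻ r in Ioc 0 ε, f r ^ s = ∫⁻ r in Ioi 0, (Ioc 0 ε).indicator f r ^ s := by
    have : (fun r => (Ioc 0 ε).indicator f r ^ s) = (Ioc 0 ε).indicator fun r => f r ^ s := by
      ext r
      by_cases hr : r ∈ Ioc 0 ε <;> simp [hr, hs0]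
    rw [this, lintegral_indicator measurableSet_Ioc, Measure.restrict_restrict measurableSet_Ioc,
      inter_eq_left.2 Ioc_subset_Ioi_self]
  rw [hI]
  refine le_trans ?_ (lintegral_hardy hs (hf.indicator measurableSet_Ioc))
  refine le_trans ?_ (lintegral_mono_set (Ioc_subset_Ioi_self : Ioc 0 ε ⊆ Ioi 0))
  refine setLIntegral_mono' measurableSet_Ioc fun t ht => ?_
  have ht0 : 0 < t := ht.1
  have hK := kFunctional_nonneg ι ht0.le x
  have hI' : ∫⁻ r in Ioc 0 t, (Ioc 0 ε).indicator f r = ∫⁻ r in Ioc 0 t, f r :=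
    setLIntegral_congr_fun measurableSet_Ioc fun r hr =>
      indicator_of_mem (show r ∈ Ioc 0 ε from ⟨hr.1, hr.2.trans ht.2⟩) f
  rw [hI']
  calc _ = (ENNReal.ofReal t⁻¹ * ENNReal.ofReal (kFunctional ι t x)) ^ s := by
        rw [Real.enorm_of_nonneg (by positivity), ← ENNReal.ofReal_mul (by positivity),
          ENNReal.ofReal_rpow_of_nonneg (by positivity) hs0.le,
          ENNReal.ofReal_rpow_of_nonneg (by positivity) hs0.le,
          ← ENNReal.ofReal_mul (by positivity), Real.mul_rpow (by positivity) hK,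
          Real.mul_rpow (by positivity) hK, ← mul_assoc, ← Real.rpow_mul ht0.le,
          ← Real.rpow_neg_one, ← Real.rpow_mul ht0.le, ← Real.rpow_add ht0]
        congr 3
        field_simp
        ring
    _ ≤ _ := by
        gcongr
        exact h t ht

/-- The integrand is at most M t^(α - θ - 1), integrable at zero because θ < α. -/
theorem realInterpENormBelow_one_le_of_kFunctional_le_rpow (ι : Y →L[𝕜] X) {θ α : ℝ} (hα : θ < α)
    {ε : ℝ} (hε : 0 ≤ ε) {x : X} {M : ℝ} (hM : 0 ≤ M)
    (h : ∀ t ∈ Ioc 0 ε, kFunctional ι t x ≤ M * t ^ α) :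
    realInterpENormBelow ι θ 1 ε x ≤ ENNReal.ofReal (M * (ε ^ (α - θ) / (α - θ))) := by
  rw [realInterpENormBelow, eLpNorm_one_eq_lintegral_enorm, setLIntegral_dtOverT measurableSet_Iic,
    Iic_inter_Ioi, ENNReal.ofReal_mul hM, ← lintegral_Ioc_rpow_sub_one (sub_pos.2 hα) hε,
    ← lintegral_const_mul _ (by fun_prop)]
  refine setLIntegral_mono' measurableSet_Ioc fun t ht => ?_
  have ht0 : 0 < t := ht.1
  have hK := kFunctional_nonneg ι ht0.le x
  rw [Real.enorm_of_nonneg (by positivity), ← ENNReal.ofReal_mul (by positivity),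
    ← ENNReal.ofReal_mul hM]
  refine ENNReal.ofReal_le_ofReal ?_
  calc t⁻¹ * (t ^ (-θ) * kFunctional ι t x) ≤ t⁻¹ * (t ^ (-θ) * (M * t ^ α)) := by
        gcongr
        exact h t ht
    _ = M * t ^ (α - θ - 1) := by
        rw [Real.rpow_sub_one ht0.ne', Real.rpow_sub ht0, Real.rpow_neg ht0.le]
        field_simp

end RealInterpolation

/-! ### The continuous representative and its K-functional -/

section Representative

theorem lintegral_le_rpow_lintegral_mul_measure {α : Type*} [MeasurableSpace α] {μ : Measure α}
    {s : ℝ} (hs : 1 < s) {f : α → ℝ≥0∞} (hf : AEMeasurable f μ) :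
    ∫⁻ r, f r ∂μ ≤ (∫⁻ r, f r ^ s ∂μ) ^ (1 / s) * μ univ ^ (1 - 1 / s) := by
  have hs0 : 0 < s := by linarith
  have hpq : s.HolderConjugate (1 - 1 / s)⁻¹ := by
    refine (Real.holderConjugate_iff).2 ⟨hs, ?_⟩
    rw [inv_inv]; simp
  have h := ENNReal.lintegral_mul_le_Lp_mul_Lq μ hpq hf (g := fun _ => 1) aemeasurable_const
  simpa using h

variable {𝕜 X Y : Type*} [RCLike 𝕜] [NormedAddCommGroup X] [NormedSpace 𝕜 X]
  [NormedAddCommGroup Y] [NormedSpace 𝕜 Y] [NormedSpace ℝ X] [IsScalarTower ℝ 𝕜 X]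

/-- If `u` is a primitive of `v` that agrees almost everywhere with the `Y`-valued function `w`,
then averaging `w` over a neighbourhood of `t` of length at least `h` bounds `K(h, u(t))`. -/
theorem kFunctional_le_of_primitive [CompleteSpace X] [CompleteSpace Y] (ι : Y →L[𝕜] X)
    {u v : ℝ → X} {w : ℝ → Y} {a b h t : ℝ} (hh : 0 < h) (hab : h ≤ b - a) (ht : t ∈ Icc a b)
    (hv : IntegrableOn v (Ioo a b)) (hw : IntegrableOn w (Ioo a b))
    (hu : ∀ r ∈ Icc a b, ∀ r' ∈ Icc a b, u r' - u r = ∫ x in r..r', v x)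
    (huw : ∀ᵐ r ∂volume.restrict (Ioo a b), ι (w r) = u r) :
    ENNReal.ofReal (kFunctional ι h (u t)) ≤ ∫⁻ r in Ioo a b, (‖v r‖ₑ + ‖w r‖ₑ) := by
  let : NormedSpace ℝ Y := NormedSpace.restrictScalars ℝ 𝕜 Y
  have hab' : a < b := by linarith
  have hba : 0 < b - a := by linarith
  set A := ∫ r in Ioo a b, ‖v r‖ with hA
  set B := ∫ r in Ioo a b, ‖w r‖ with hB
  have hAB : ∫⁻ r in Ioo a b, (‖v r‖ₑ + ‖w r‖ₑ) = ENNReal.ofReal (A + B) := by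
    rw [lintegral_add_left' hv.1.enorm, ENNReal.ofReal_add (by positivity) (by positivity), hA, hB,
      ofReal_integral_norm_eq_lintegral_enorm hv, ofReal_integral_norm_eq_lintegral_enorm hw]
  rw [hAB]
  refine ENNReal.ofReal_le_ofReal ?_
  have hdiff : ∀ r ∈ Icc a b, ‖u t - u r‖ ≤ A := by
    intro r hr
    rw [hu r hr t ht]
    refine (intervalIntegral.norm_integral_le_integral_norm_uIoc).trans ?_
    rw [hA, ← integral_Ioc_eq_integral_Ioo]
    refine setIntegral_mono_set ?_ (.of_forall fun _ => norm_nonneg _) ?_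
    · exact ((integrableOn_Ioc_iff_integrableOn_Ioo).2 hv).norm
    · refine LE.le.eventuallyLE ?_
      exact Ioc_subset_Ioc (le_min hr.1 ht.1) (max_le hr.2 ht.2)
  -- The competitor in the infimum defining K. Its image is the mean of u, so u(t) - ι y is the mean
  -- of the differences u(t) - u(r), each of norm at most A. The bound h ≤ b - a absorbs the factor
  -- 1/(b - a) in ‖y‖.
  set y : Y := (b - a)⁻¹ • ∫ r in Ioo a b, w r with hy
  have hwι : IntegrableOn (fun r => ι (w r)) (Ioo a b) := ι.integrable_comp hw
  have hui : IntegrableOn u (Ioo a b) := hwι.congr huw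
  have hιy : ι y = (b - a)⁻¹ • ∫ r in Ioo a b, u r := by
    rw [hy, ι.map_smul_of_tower, ← ι.integral_comp_comm hw, integral_congr_ae huw]
  have hvol : volume.real (Ioo a b) = b - a := by
    rw [Real.volume_real_Ioo_of_le hab'.le]
  have h1 : ‖u t - ι y‖ ≤ A := by
    have : u t - ι y = (b - a)⁻¹ • ∫ r in Ioo a b, (u t - u r) := by
      rw [integral_sub (integrable_const (u t)) hui, setIntegral_const, hvol, smul_sub,
        inv_smul_smul₀ hba.ne', hιy]
    rw [this, norm_smul, norm_inv, Real.norm_of_nonneg hba.le, inv_mul_le_iff₀ hba, mul_comm]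
    have := norm_setIntegral_le_of_norm_le_const (μ := volume) (s := Ioo a b)
      (f := fun r => u t - u r) (C := A) (by simp)
      (fun r hr => hdiff r (Ioo_subset_Icc_self hr))
    rwa [hvol] at this
  have h2 : h * ‖y‖ ≤ B := by
    have hn : ‖y‖ ≤ (b - a)⁻¹ * B := by
      rw [hy, norm_smul, norm_inv, Real.norm_of_nonneg hba.le]
      gcongr
      exact norm_integral_le_integral_norm _
    have hB0 : 0 ≤ B := by positivity
    calc h * ‖y‖ ≤ (b - a) * ((b - a)⁻¹ * B) := by gcongr
      _ = B := by field_simp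
  exact (kFunctional_le ι hh.le (u t) y).trans (add_le_add h1 h2)

namespace MaxRegSpace

variable {ι : Y →L[𝕜] X} {T s : ℝ} [hs : Fact (1 < s)]

/-- The weak derivative of an element of `W^{1,p}(J; X) ∩ L^p(J; Y)`. -/
noncomputable def weakDeriv (U : MaxRegSpace ι (ENNReal.ofReal s) T) :
    Lp X (ENNReal.ofReal s) (volJ T) := U.1.1.1.2

/-- An element of `W^{1,p}(J; X) ∩ L^p(J; Y)` as a function with values in `Y`. -/
noncomputable def toLpY (U : MaxRegSpace ι (ENNReal.ofReal s) T) :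
    Lp Y (ENNReal.ofReal s) (volJ T) := U.1.2

theorem enorm_toLp_le (U : MaxRegSpace ι (ENNReal.ofReal s) T) : ‖toLp U‖ₑ ≤ ‖U‖ₑ :=
  enorm_le_iff_norm_le.2 ((norm_fst_le U.1.1.1).trans (norm_fst_le U.1))

theorem enorm_weakDeriv_le (U : MaxRegSpace ι (ENNReal.ofReal s) T) : ‖weakDeriv U‖ₑ ≤ ‖U‖ₑ :=
  enorm_le_iff_norm_le.2 ((norm_snd_le U.1.1.1).trans (norm_fst_le U.1))

theorem enorm_toLpY_le (U : MaxRegSpace ι (ENNReal.ofReal s) T) : ‖toLpY U‖ₑ ≤ ‖U‖ₑ :=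
  enorm_le_iff_norm_le.2 (norm_snd_le U.1)

theorem isWeakDeriv (U : MaxRegSpace ι (ENNReal.ofReal s) T) : IsWeakDeriv T (toLp U) (weakDeriv U) :=
  U.1.1.2

theorem ae_toLpY_eq (U : MaxRegSpace ι (ENNReal.ofReal s) T) :
    ∀ᵐ r ∂volJ T, ι ((toLpY U) r) = (toLp U) r := by
  have h : ι.compLp (toLpY U) = (toLp U) := U.2
  rw [← h]
  filter_upwards [ι.coeFn_compLp (toLpY U)] with r hr
  exact hr.symm

/-- The function `‖u'‖_X + ‖u‖_Y` on `J`, extended by zero. -/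
noncomputable def density (U : MaxRegSpace ι (ENNReal.ofReal s) T) : ℝ → ℝ≥0∞ :=
  (Ioo 0 T).indicator fun r => ‖weakDeriv U r‖ₑ + ‖toLpY U r‖ₑ

theorem measurable_density (U : MaxRegSpace ι (ENNReal.ofReal s) T) : Measurable (density U) := by
  refine Measurable.indicator ?_ measurableSet_Ioo
  exact (Lp.stronglyMeasurable (weakDeriv U)).enorm.add (Lp.stronglyMeasurable (toLpY U)).enorm

theorem integrable_coeFn {Z : Type*} [NormedAddCommGroup Z]
    (f : Lp Z (ENNReal.ofReal s) (volJ T)) : Integrable f (volJ T) :=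
  (Lp.memLp f).integrable (factOneLeOfReal s).out

theorem enorm_eq_lintegral {Z : Type*} [NormedAddCommGroup Z]
    (f : Lp Z (ENNReal.ofReal s) (volJ T)) :
    ‖f‖ₑ = (∫⁻ r in Ioo 0 T, ‖f r‖ₑ ^ s) ^ (1 / s) := by
  have hs0 : 0 < s := by linarith [hs.out]
  rw [Lp.enorm_def, eLpNorm_eq_lintegral_rpow_enorm_toReal (by simpa using hs0)
    ENNReal.ofReal_ne_top, ENNReal.toReal_ofReal hs0.le]

/-- Minkowski's inequality; the factor 2 counts the two summands of the density, each bounded by the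
maximum norm of `U`. -/
theorem lintegral_density_rpow_le (U : MaxRegSpace ι (ENNReal.ofReal s) T) :
    (∫⁻ r, density U r ^ s) ^ (1 / s) ≤ 2 * ‖U‖ₑ := by
  have hs0 : 0 < s := by linarith [hs.out]
  have h1 : (fun r => density U r ^ s) = (Ioo 0 T).indicator fun r =>
      ((fun r => ‖weakDeriv U r‖ₑ) + fun r => ‖toLpY U r‖ₑ) r ^ s := by
    ext r
    by_cases hr : r ∈ Ioo 0 T <;> simp [density, hr, hs0]
  rw [h1, lintegral_indicator measurableSet_Ioo]
  refine (ENNReal.lintegral_Lp_add_le (Lp.stronglyMeasurable (weakDeriv U)).enorm.aemeasurable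
    (Lp.stronglyMeasurable (toLpY U)).enorm.aemeasurable hs.out.le).trans ?_
  rw [← enorm_eq_lintegral, ← enorm_eq_lintegral, two_mul]
  exact add_le_add (enorm_weakDeriv_le U) (enorm_toLpY_le U)

theorem lintegral_density_le (U : MaxRegSpace ι (ENNReal.ofReal s) T) (S : Set ℝ) :
    ∫⁻ r in S, density U r ≤ 2 * ‖U‖ₑ * volume S ^ (1 - 1 / s) := by
  have hs0 : 0 < s := by linarith [hs.out]
  refine (lintegral_le_rpow_lintegral_mul_measure hs.out
    (measurable_density U).aemeasurable).trans ?_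
  rw [Measure.restrict_apply_univ]
  gcongr
  refine le_trans ?_ (lintegral_density_rpow_le U)
  gcongr
  exact Measure.restrict_le_self

/-- The function `u` is the continuous representative of `U`: it is a primitive of the weak
derivative of `U`. -/
structure IsRep (U : MaxRegSpace ι (ENNReal.ofReal s) T) (u : ℝ → X) : Prop where
  ae_eq : u =ᵐ[volJ T] (toLp U)
  sub_eq : ∀ a ∈ Icc 0 T, ∀ b ∈ Icc 0 T, u b - u a = ∫ r in a..b, weakDeriv U r

theorem exists_isRep [CompleteSpace X] (hT : 0 < T) (U : MaxRegSpace ι (ENNReal.ofReal s) T) :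
    ∃ u, IsRep U u := by
  have hv := integrable_coeFn (weakDeriv U)
  obtain ⟨c, hc⟩ := (isWeakDeriv U).exists_ae_eq_add_primitive hT (integrable_coeFn (toLp U)) hv
  refine ⟨_, hc.symm, fun a ha b hb => ?_⟩
  have hi : ∀ b ∈ Icc 0 T, IntervalIntegrable (weakDeriv U) volume 0 b := fun b hb => by
    rw [intervalIntegrable_iff_integrableOn_Ioo_of_le hb.1]
    exact IntegrableOn.mono_set hv (Ioo_subset_Ioo_right hb.2)
  rw [add_sub_add_left_eq_sub, intervalIntegral.integral_interval_sub_left (hi b hb) (hi a ha)]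

theorem IsRep.kFunctional_le [CompleteSpace X] [CompleteSpace Y]
    {U : MaxRegSpace ι (ENNReal.ofReal s) T} {u : ℝ → X} (hu : IsRep U u)
    {t h : ℝ} (ht : t ∈ Icc 0 T) (hh : h ∈ Ioc 0 T) :
    ENNReal.ofReal (kFunctional ι h (u t)) ≤ ∫⁻ r in Ioo (t - h) (t + h), density U r := by
  have hsub : Ioo (max (t - h) 0) (min (t + h) T) ⊆ Ioo 0 T :=
    Ioo_subset_Ioo (le_max_right _ _) (min_le_right _ _)
  have hsubI : Icc (max (t - h) 0) (min (t + h) T) ⊆ Icc 0 T :=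
    Icc_subset_Icc (le_max_right _ _) (min_le_right _ _)
  -- The window keeps length at least h inside J: one of its halves survives, unless it is clipped
  -- at both ends and equals J, and then h ≤ T is used.
  have hlen : h ≤ min (t + h) T - max (t - h) 0 := by
    rcases hh with ⟨h0, h1⟩
    rcases ht with ⟨t0, t1⟩
    rcases min_cases (t + h) T with ⟨e, _⟩ | ⟨e, _⟩ <;>
    rcases max_cases (t - h) 0 with ⟨e', _⟩ | ⟨e', _⟩ <;> rw [e, e'] <;> linarith
  have hm : t ∈ Icc (max (t - h) 0) (min (t + h) T) :=
    ⟨max_le (by linarith [hh.1]) ht.1, le_min (by linarith [hh.1]) ht.2⟩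
  have hae : ∀ᵐ r ∂volJ T, ι ((toLpY U) r) = u r := by
    filter_upwards [(ae_toLpY_eq U), hu.ae_eq] with r h1 h2
    rw [h1, h2]
  refine (kFunctional_le_of_primitive ι hh.1 hlen hm
    (IntegrableOn.mono_set (integrable_coeFn (weakDeriv U)) hsub)
    (IntegrableOn.mono_set (integrable_coeFn (toLpY U)) hsub)
    (fun r hr r' hr' => hu.sub_eq r (hsubI hr) r' (hsubI hr'))
    (ae_restrict_of_ae_restrict_of_subset hsub hae)).trans ?_
  rw [setLIntegral_congr_fun (g := (density U)) measurableSet_Ioo fun r hr =>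
    (indicator_of_mem (hsub hr) (fun r => ‖weakDeriv U r‖ₑ + ‖toLpY U r‖ₑ)).symm]
  exact lintegral_mono_set (Ioo_subset_Ioo (le_max_left _ _) (min_le_left _ _))

theorem IsRep.enorm_sub_le {U : MaxRegSpace ι (ENNReal.ofReal s) T} {u : ℝ → X}
    (hu : IsRep U u) {t t' : ℝ} (ht : t ∈ Icc 0 T) (ht' : t' ∈ Icc 0 T) :
    ‖u t - u t'‖ₑ ≤ 2 * ‖U‖ₑ * ENNReal.ofReal |t - t'| ^ (1 - 1 / s) := by
  rw [hu.sub_eq t' ht' t ht]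
  have h1 : ‖∫ r in t'..t, weakDeriv U r‖ₑ ≤ ∫⁻ r in uIoc t' t, ‖weakDeriv U r‖ₑ := by
    rw [← enorm_norm, intervalIntegral.norm_intervalIntegral_eq, enorm_norm]
    exact enorm_integral_le_lintegral_enorm _
  have h2 : ∫⁻ r in uIoc t' t, ‖weakDeriv U r‖ₑ ≤ ∫⁻ r in uIoc t' t, density U r := by
    have : uIoc t' t =ᵐ[volume] Ioo (min t' t) (max t' t) := Ioo_ae_eq_Ioc.symm
    rw [setLIntegral_congr this, setLIntegral_congr this]
    refine setLIntegral_mono' measurableSet_Ioo fun r hr => ?_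
    have : r ∈ Ioo 0 T := ⟨(le_min ht'.1 ht.1).trans_lt hr.1, hr.2.trans_le (max_le ht'.2 ht.2)⟩
    rw [density, indicator_of_mem this]
    exact le_self_add
  refine (h1.trans h2).trans (((lintegral_density_le U) _).trans_eq ?_)
  rw [uIoc, Real.volume_Ioc, max_sub_min_eq_abs]

/-- Averaging ‖u(t)‖ ≤ ‖u(r)‖ + ‖u(t) - u(r)‖ over r in J bounds the value at t by the mean of ‖u‖,
controlled by the L^s norm, plus the oscillation, controlled by Hölder continuity. -/
theorem IsRep.exists_enorm_le (hT : 0 < T) : ∃ C : ℝ≥0,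
    ∀ (U : MaxRegSpace ι (ENNReal.ofReal s) T) (u : ℝ → X), IsRep U u →
      ∀ t ∈ Icc 0 T, ‖u t‖ₑ ≤ C * ‖U‖ₑ := by
  have hs0 : 0 < s := by linarith [hs.out]
  have hb0 : 0 < 1 - 1 / s := by rw [sub_pos, div_lt_one hs0]; exact hs.out
  have hTe : ENNReal.ofReal T ≠ 0 := by simpa using hT
  set D : ℝ≥0∞ := ENNReal.ofReal T ^ (1 - 1 / s) with hD
  have hDt : D ≠ ⊤ := ENNReal.rpow_ne_top_of_nonneg hb0.le ENNReal.ofReal_ne_top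
  refine ⟨((ENNReal.ofReal T)⁻¹ * D + 2 * D).toNNReal, fun U u hu t ht => ?_⟩
  rw [ENNReal.coe_toNNReal (by finiteness)]
  have hpt : ∀ r ∈ Ioo 0 T, ‖u t‖ₑ ≤ ‖u r‖ₑ + 2 * ‖U‖ₑ * D := by
    intro r hr
    have h1 : ‖u t‖ₑ ≤ ‖u r‖ₑ + ‖u t - u r‖ₑ := by
      simpa using enorm_add_le (u r) (u t - u r)
    refine h1.trans (add_le_add le_rfl ((hu.enorm_sub_le ht (Ioo_subset_Icc_self hr)).trans ?_))
    rw [hD]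
    gcongr
    rw [abs_le]
    constructor <;> linarith [hr.1, hr.2, ht.1, ht.2]
  have hint := setLIntegral_mono' (μ := volume) measurableSet_Ioo hpt
  have hu1 : ∫⁻ r in Ioo 0 T, ‖u r‖ₑ ≤ ‖U‖ₑ * D := by
    have : ∫⁻ r in Ioo 0 T, ‖u r‖ₑ = ∫⁻ r in Ioo 0 T, ‖toLp U r‖ₑ :=
      lintegral_congr_ae (hu.ae_eq.fun_comp (‖·‖ₑ))
    rw [this]
    refine (lintegral_le_rpow_lintegral_mul_measure hs.out
      (Lp.stronglyMeasurable (toLp U)).enorm.aemeasurable).trans ?_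
    rw [← enorm_eq_lintegral, Measure.restrict_apply_univ, Real.volume_Ioo, sub_zero]
    gcongr
    exact (enorm_toLp_le U)
  rw [lintegral_add_right _ measurable_const, setLIntegral_const, setLIntegral_const,
    Real.volume_Ioo, sub_zero] at hint
  have hle : ‖u t‖ₑ * ENNReal.ofReal T ≤ (‖U‖ₑ * D + 2 * ‖U‖ₑ * D * ENNReal.ofReal T) :=
    hint.trans (add_le_add hu1 le_rfl)
  rw [← ENNReal.le_div_iff_mul_le (Or.inl hTe) (Or.inl ENNReal.ofReal_ne_top)] at hle
  refine hle.trans (le_of_eq ?_)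
  rw [ENNReal.add_div, ENNReal.mul_div_cancel_right hTe ENNReal.ofReal_ne_top, div_eq_mul_inv]
  ring

theorem IsRep.continuousOn {U : MaxRegSpace ι (ENNReal.ofReal s) T} {u : ℝ → X}
    (hu : IsRep U u) : ContinuousOn u (Icc 0 T) := by
  have hs0 : 0 < s := by linarith [hs.out]
  have hb0 : 0 < 1 - 1 / s := by rw [sub_pos, div_lt_one hs0]; exact hs.out
  have h : HolderOnWith (2 * ‖U‖₊) (1 - 1 / s).toNNReal u (Icc 0 T) := by
    intro t ht t' ht'
    rw [edist_eq_enorm_sub, edist_dist, Real.dist_eq, Real.coe_toNNReal _ hb0.le]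
    exact hu.enorm_sub_le ht ht'
  exact h.continuousOn (by simpa using hb0)

/-- Continuity upgrades equality almost everywhere to equality on the closed interval. Uniqueness
makes the choice of representative linear in `U`. -/
theorem IsRep.eqOn (hT : 0 < T) {U : MaxRegSpace ι (ENNReal.ofReal s) T} {u u' : ℝ → X}
    (hu : IsRep U u) (hu' : IsRep U u') : EqOn u u' (Icc 0 T) := by
  refine Measure.eqOn_Icc_of_ae_eq volume hT.ne ?_ hu.continuousOn hu'.continuousOn
  rw [← restrict_Ioo_eq_restrict_Icc]
  exact hu.ae_eq.trans hu'.ae_eq.symm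

theorem intervalIntegral_congr_volJ {f g : ℝ → X} (h : f =ᵐ[volJ T] g) {a b : ℝ}
    (ha : a ∈ Icc 0 T) (hb : b ∈ Icc 0 T) : ∫ r in a..b, f r = ∫ r in a..b, g r := by
  refine intervalIntegral.integral_congr_ae_restrict ?_
  rw [volJ, restrict_Ioo_eq_restrict_Ioc] at h
  exact ae_restrict_of_ae_restrict_of_subset
    (Ioc_subset_Ioc (le_min ha.1 hb.1) (max_le ha.2 hb.2)) h

theorem intervalIntegrable_coeFn {Z : Type*} [NormedAddCommGroup Z]
    (f : Lp Z (ENNReal.ofReal s) (volJ T)) {a b : ℝ}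
    (ha : a ∈ Icc 0 T) (hb : b ∈ Icc 0 T) : IntervalIntegrable f volume a b := by
  rw [intervalIntegrable_iff]
  refine IntegrableOn.mono_set (t := Ioc 0 T) ?_
    (Ioc_subset_Ioc (le_min ha.1 hb.1) (max_le ha.2 hb.2))
  rw [integrableOn_Ioc_iff_integrableOn_Ioo]
  exact integrable_coeFn f

theorem IsRep.add {U U' : MaxRegSpace ι (ENNReal.ofReal s) T} {u u' : ℝ → X} (hu : IsRep U u)
    (hu' : IsRep U' u') : IsRep (U + U') (u + u') where
  ae_eq := (hu.ae_eq.add hu'.ae_eq).trans (Lp.coeFn_add (toLp U) (toLp U')).symm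
  sub_eq a ha b hb := by
    have h : (weakDeriv (U + U') : ℝ → X) =ᵐ[volJ T] weakDeriv U + weakDeriv U' :=
      Lp.coeFn_add (weakDeriv U) (weakDeriv U')
    rw [intervalIntegral_congr_volJ h ha hb]
    simp only [Pi.add_apply]
    rw [intervalIntegral.integral_add (intervalIntegrable_coeFn _ ha hb)
      (intervalIntegrable_coeFn _ ha hb), ← hu.sub_eq a ha b hb, ← hu'.sub_eq a ha b hb]
    abel

theorem IsRep.smul {U : MaxRegSpace ι (ENNReal.ofReal s) T} {u : ℝ → X} (hu : IsRep U u) (c : 𝕜) :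
    IsRep (c • U) (c • u) where
  ae_eq := (hu.ae_eq.const_smul c).trans (Lp.coeFn_smul c (toLp U)).symm
  sub_eq a ha b hb := by
    have : SMulCommClass ℝ 𝕜 X := IsScalarTower.to_smulCommClass
    have h : (weakDeriv (c • U) : ℝ → X) =ᵐ[volJ T] c • (weakDeriv U : ℝ → X) :=
      Lp.coeFn_smul c (weakDeriv U)
    rw [intervalIntegral_congr_volJ h ha hb]
    simp only [Pi.smul_apply]
    rw [intervalIntegral.integral_smul, ← hu.sub_eq a ha b hb, smul_sub]

/-- An element of `W^{1,p}(J; X) ∩ L^p(J; Y)` is determined by its values in `X`. -/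
theorem eq_zero_of_ae_eq_zero [CompleteSpace X] (hι : Function.Injective ι)
    {U : MaxRegSpace ι (ENNReal.ofReal s) T} (h : toLp U =ᵐ[volJ T] 0) : U = 0 := by
  have h1 : toLp U = 0 := Lp.eq_zero_iff_ae_eq_zero.2 h
  have h2 : weakDeriv U = 0 := by
    refine Lp.eq_zero_iff_ae_eq_zero.2 (ae_eq_zero_of_integral_testFunction_smul
      (integrable_coeFn _) fun η e1 e2 e3 => ?_)
    rw [← neg_eq_zero, ← isWeakDeriv U η e1 e2 e3]
    refine integral_eq_zero_of_ae ?_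
    filter_upwards [h] with r hr
    rw [hr, Pi.zero_apply, smul_zero]
  have h3 : toLpY U = 0 := by
    refine Lp.eq_zero_iff_ae_eq_zero.2 ?_
    filter_upwards [h, ae_toLpY_eq U] with r hr hr'
    exact hι ((hr'.trans hr).trans (map_zero ι).symm)
  exact Subtype.ext (Prod.ext (Subtype.ext (Prod.ext h1 h2)) h3)

end MaxRegSpace

end Representative

/-! ### Bounds and moduli of continuity in the interpolation spaces -/

section Embedding

variable {𝕜 X Y : Type*} [RCLike 𝕜] [NormedAddCommGroup X] [NormedSpace 𝕜 X]
  [NormedAddCommGroup Y] [NormedSpace 𝕜 Y] [NormedSpace ℝ X] [IsScalarTower ℝ 𝕜 X]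

/-- Folding the window at t turns a two-sided integral into one over (0, h] whose integrand does not
depend on h, the form that Hardy's inequality needs. -/
theorem lintegral_Ioo_le_lintegral_Ioc_reflect {G : ℝ → ℝ≥0∞} (hG : Measurable G) (t h : ℝ) :
    ∫⁻ r in Ioo (t - h) (t + h), G r ≤ ∫⁻ r in Ioc 0 h, (G (t + r) + G (t - r)) := by
  have e1 : ∫⁻ r in Ioc 0 h, G (t + r) = ∫⁻ r in Ioc t (t + h), G r := by
    have := (measurePreserving_add_left volume t).setLIntegral_comp_preimage
      (measurableSet_Ioc (a := t) (b := t + h)) hG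
    rw [← this]
    congr 2
    ext r; simp
  have e2 : ∫⁻ r in Ioc 0 h, G (t - r) = ∫⁻ r in Ico (t - h) t, G r := by
    have := (Measure.measurePreserving_sub_left volume t).setLIntegral_comp_preimage
      (measurableSet_Ico (a := t - h) (b := t)) hG
    rw [← this]
    congr 2
    ext r; simp [and_comm]
  rw [lintegral_add_left (by fun_prop), e1, e2,
    setLIntegral_congr (Ico_ae_eq_Icc (a := t - h) (b := t))]
  refine (lintegral_mono_set ?_).trans (lintegral_union_le _ _ _)
  intro r hr
  rcases le_or_gt r t with h' | h'
  · exact Or.inr ⟨hr.1.le, h'⟩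
  · exact Or.inl ⟨h', hr.2.le⟩

theorem rpow_lintegral_Ioc_reflect_le {s : ℝ} (hs : 1 < s) {G : ℝ → ℝ≥0∞} (hG : Measurable G)
    (t ε : ℝ) :
    (∫⁻ r in Ioc 0 ε, (G (t + r) + G (t - r)) ^ s) ^ (1 / s) ≤
      2 * (∫⁻ r in Icc (t - ε) (t + ε), G r ^ s) ^ (1 / s) := by
  have hGs : Measurable fun r => G r ^ s := by fun_prop
  have hs0 : 0 < s := by linarith
  refine (ENNReal.lintegral_Lp_add_le (f := fun r => G (t + r)) (g := fun r => G (t - r))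
    (by fun_prop) (by fun_prop) hs.le).trans ?_
  have e1 : ∫⁻ r in Ioc 0 ε, G (t + r) ^ s ≤ ∫⁻ r in Icc (t - ε) (t + ε), G r ^ s := by
    have := (measurePreserving_add_left volume t).setLIntegral_comp_preimage
      (measurableSet_Icc (a := t - ε) (b := t + ε)) hGs
    rw [← this]
    refine lintegral_mono_set fun r hr => ?_
    simp only [mem_preimage, mem_Icc]
    constructor <;> linarith [hr.1, hr.2]
  have e2 : ∫⁻ r in Ioc 0 ε, G (t - r) ^ s ≤ ∫⁻ r in Icc (t - ε) (t + ε), G r ^ s := by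
    have := (Measure.measurePreserving_sub_left volume t).setLIntegral_comp_preimage
      (measurableSet_Icc (a := t - ε) (b := t + ε)) hGs
    rw [← this]
    refine lintegral_mono_set fun r hr => ?_
    simp only [mem_preimage, mem_Icc]
    constructor <;> linarith [hr.1, hr.2]
  rw [two_mul]
  gcongr

namespace MaxRegSpace

variable {ι : Y →L[𝕜] X} {T s : ℝ} [hs : Fact (1 < s)] [CompleteSpace X] [CompleteSpace Y]

theorem one_sub_one_div_pos (s : ℝ) [hs : Fact (1 < s)] : 0 < 1 - 1 / s := by
  have hs0 : 0 < s := by linarith [hs.out]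
  rw [sub_pos, div_lt_one hs0]
  exact hs.out

/-- The right side sees the density only on the window around t; this locality is what later gives
smallness uniformly in t. -/
theorem IsRep.realInterpENormBelow_le {U : MaxRegSpace ι (ENNReal.ofReal s) T} {u : ℝ → X}
    (hu : IsRep U u) {t ε : ℝ} (ht : t ∈ Icc 0 T) (hε : ε ≤ T) :
    realInterpENormBelow ι (1 - 1 / s) (ENNReal.ofReal s) ε (u t) ≤
      ENNReal.ofReal (1 - 1 / s)⁻¹ *
        (2 * (∫⁻ r in Icc (t - ε) (t + ε), density U r ^ s) ^ (1 / s)) := by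
  have hm := measurable_density U
  refine (realInterpENormBelow_le_of_kFunctional_le_lintegral ι hs.out
    (f := fun r => density U (t + r) + density U (t - r)) (by fun_prop) fun h hh => ?_).trans ?_
  · exact (hu.kFunctional_le ht ⟨hh.1, hh.2.trans hε⟩).trans
      (lintegral_Ioo_le_lintegral_Ioc_reflect hm t h)
  · gcongr
    exact rpow_lintegral_Ioc_reflect_le hs.out hm t ε

theorem IsRep.exists_realInterpENorm_le (hT : 0 < T) : ∃ C : ℝ≥0,
    ∀ (U : MaxRegSpace ι (ENNReal.ofReal s) T) (u : ℝ → X), IsRep U u → ∀ t ∈ Icc 0 T,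
      realInterpENorm ι (1 - 1 / s) (ENNReal.ofReal s) (u t) ≤ C * ‖U‖ₑ := by
  have hs0 : 0 < s := by linarith [hs.out]
  obtain ⟨C, hC⟩ := IsRep.exists_enorm_le (ι := ι) (s := s) hT
  set D := eLpNorm (fun t : ℝ => t ^ (-(1 - 1 / s))) (ENNReal.ofReal s) (dtOverT.restrict (Ioi T))
    with hD
  have hDt : D ≠ ⊤ := (eLpNorm_rpow_neg_Ioi_lt_top (one_sub_one_div_pos s) hs0 hT).ne
  -- The cut is at T, the largest level at which the bound on K is available. One factor 2 comes
  -- from folding the window, the other from the two summands of the density; C * D is the part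
  -- above T.
  refine ⟨(ENNReal.ofReal (1 - 1 / s)⁻¹ * (2 * 2) + C * D).toNNReal, fun U u hu t ht => ?_⟩
  rw [ENNReal.coe_toNNReal (by finiteness)]
  refine (realInterpENorm_le_below_add ι _ _ hT (u t)).trans ?_
  rw [add_mul, mul_assoc, mul_assoc 2, mul_right_comm]
  refine add_le_add ((hu.realInterpENormBelow_le ht le_rfl).trans ?_) ?_
  · gcongr
    refine le_trans ?_ (lintegral_density_rpow_le U)
    gcongr
    exact Measure.restrict_le_self
  · gcongr
    exact hC U u hu t ht

/-- First ε is fixed so that the parts of the norms of u(t) and u(t') below ε are each at most η/3,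
uniformly in t and t'. Only then is |t - t'| made small, so that the part above ε, with its
ε-dependent constant D, is at most η/3. -/
theorem IsRep.exists_realInterpENorm_sub_le (hT : 0 < T)
    {U : MaxRegSpace ι (ENNReal.ofReal s) T} {u : ℝ → X} (hu : IsRep U u) {η : ℝ≥0∞}
    (hη : η ≠ 0) : ∃ δ > 0, ∀ t ∈ Icc 0 T, ∀ t' ∈ Icc 0 T, |t - t'| < δ →
      realInterpENorm ι (1 - 1 / s) (ENNReal.ofReal s) (u t - u t') ≤ η := by
  have hs0 : 0 < s := by linarith [hs.out]
  have hη3 : 0 < η / 3 := ENNReal.div_pos hη (by simp)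
  set c : ℝ≥0∞ := ENNReal.ofReal (1 - 1 / s)⁻¹ * 2 with hc
  have hct : c ≠ ⊤ := by finiteness
  have hfin : ∫⁻ r, density U r ^ s ≠ ⊤ := by
    intro h
    have := lintegral_density_rpow_le U
    rw [h, ENNReal.top_rpow_of_pos (by positivity), top_le_iff] at this
    exact (by finiteness : 2 * ‖U‖ₑ ≠ ⊤) this
  have hlim : Tendsto (fun x : ℝ≥0∞ => c * x ^ (1 / s)) (nhds 0) (nhds 0) := by
    have := ((ENNReal.continuous_const_mul hct).comp
      (ENNReal.continuous_rpow_const (y := 1 / s))).tendsto 0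
    simpa [Function.comp_def, hs0] using this
  obtain ⟨ρ, hρ, hρη⟩ := ENNReal.nhds_zero_basis.eventually_iff.1 (hlim.eventually_lt_const hη3)
  -- Absolute continuity of the integral of the s-th power of the density; windows of length 2ε ≤ r
  -- < δ are then small enough, wherever they are centred.
  obtain ⟨δ, hδ, hδρ⟩ := exists_pos_setLIntegral_lt_of_measure_lt hfin hρ.ne'
  obtain ⟨r, hr, hrδ⟩ := ENNReal.lt_iff_exists_nnreal_btwn.1 hδ
  have hr0 : 0 < (r : ℝ) := by exact_mod_cast hr
  set ε := min T (r / 2) with hεdef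
  have hε : 0 < ε := lt_min hT (by positivity)
  have hbelow : ∀ t ∈ Icc 0 T,
      realInterpENormBelow ι (1 - 1 / s) (ENNReal.ofReal s) ε (u t) ≤ η / 3 := by
    intro t ht
    refine (hu.realInterpENormBelow_le ht (min_le_left _ _)).trans ?_
    rw [← mul_assoc, ← hc]
    refine (hρη (mem_Iio.2 (hδρ _ ?_))).le
    rw [Real.volume_Icc]
    refine lt_of_le_of_lt ?_ hrδ
    rw [← ENNReal.ofReal_coe_nnreal]
    exact ENNReal.ofReal_le_ofReal (by linarith [min_le_right T (r / 2 : ℝ)])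
  set D := eLpNorm (fun t : ℝ => t ^ (-(1 - 1 / s))) (ENNReal.ofReal s) (dtOverT.restrict (Ioi ε))
  have hDt : D ≠ ⊤ := (eLpNorm_rpow_neg_Ioi_lt_top (one_sub_one_div_pos s) hs0 hε).ne
  have hlim' : Tendsto (fun d : ℝ => 2 * ‖U‖ₑ * D * ENNReal.ofReal d ^ (1 - 1 / s))
      (nhds 0) (nhds 0) := by
    have := ((ENNReal.continuous_const_mul (by finiteness : 2 * ‖U‖ₑ * D ≠ ⊤)).comp
      ((ENNReal.continuous_rpow_const (y := 1 - 1 / s)).comp ENNReal.continuous_ofReal)).tendsto 0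
    simpa only [Function.comp_def, ENNReal.ofReal_zero,
      ENNReal.zero_rpow_of_pos (one_sub_one_div_pos s), mul_zero] using this
  obtain ⟨δ', hδ', hδη⟩ := Metric.eventually_nhds_iff.1 (hlim'.eventually_lt_const hη3)
  refine ⟨δ', hδ', fun t ht t' ht' hd => ?_⟩
  have hX : ‖u t - u t'‖ₑ * D ≤ η / 3 := by
    refine le_trans ?_ (hδη (y := |t - t'|) (by simpa using hd)).le
    rw [mul_right_comm]
    gcongr
    exact hu.enorm_sub_le ht ht'
  calc _ ≤ _ := realInterpENorm_le_below_add ι _ _ hε _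
    _ ≤ η / 3 + η / 3 + η / 3 := add_le_add ((realInterpENormBelow_sub_le ι _ _ ε _ _).trans
        (add_le_add (hbelow t ht) (hbelow t' ht'))) hX
    _ = η := ENNReal.add_thirds η

theorem IsRep.kFunctional_le_rpow {U : MaxRegSpace ι (ENNReal.ofReal s) T} {u : ℝ → X}
    (hu : IsRep U u) {t h : ℝ} (ht : t ∈ Icc 0 T) (hh : h ∈ Ioc 0 T) :
    kFunctional ι h (u t) ≤ 2 * ‖U‖ * 2 ^ (1 - 1 / s) * h ^ (1 - 1 / s) := by
  have hh0 : 0 < h := hh.1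
  have h1 := (hu.kFunctional_le ht hh).trans (lintegral_density_le U _)
  rw [Real.volume_Ioo, ← ofReal_norm, ENNReal.ofReal_rpow_of_nonneg (by linarith)
    (one_sub_one_div_pos s).le, ← ENNReal.ofReal_ofNat, ← ENNReal.ofReal_mul (by positivity),
    ← ENNReal.ofReal_mul (by positivity), ENNReal.ofReal_le_ofReal_iff
      (mul_nonneg (by positivity) (Real.rpow_nonneg (by linarith) _))] at h1
  refine h1.trans_eq ?_
  rw [show t + h - (t - h) = 2 * h by ring, Real.mul_rpow (by positivity) hh0.le]
  ring

theorem IsRep.realInterpENormBelow_one_le {U : MaxRegSpace ι (ENNReal.ofReal s) T} {u : ℝ → X}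
    (hu : IsRep U u) {θ : ℝ} (hθ : θ < 1 - 1 / s) {t ε : ℝ} (ht : t ∈ Icc 0 T) (hε : ε ∈ Icc 0 T) :
    realInterpENormBelow ι θ 1 ε (u t) ≤ ENNReal.ofReal
      (2 * ‖U‖ * 2 ^ (1 - 1 / s) * (ε ^ (1 - 1 / s - θ) / (1 - 1 / s - θ))) :=
  realInterpENormBelow_one_le_of_kFunctional_le_rpow ι hθ hε.1 (by positivity) fun _ hh =>
    hu.kFunctional_le_rpow ht ⟨hh.1, hh.2.trans hε.2⟩

theorem IsRep.exists_realInterpENorm_one_le (hT : 0 < T) {θ : ℝ} (hθ : θ ∈ Ioo 0 (1 - 1 / s)) :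
    ∃ C : ℝ≥0, ∀ (U : MaxRegSpace ι (ENNReal.ofReal s) T) (u : ℝ → X), IsRep U u →
      ∀ t ∈ Icc 0 T, realInterpENorm ι θ 1 (u t) ≤ C * ‖U‖ₑ := by
  obtain ⟨C, hC⟩ := IsRep.exists_enorm_le (ι := ι) (s := s) hT
  have hβ : 0 < 1 - 1 / s - θ := sub_pos.2 hθ.2
  have hθ0 := hθ.1
  refine ⟨(2 * 2 ^ (1 - 1 / s) * (T ^ (1 - 1 / s - θ) / (1 - 1 / s - θ))).toNNReal +
    C * (T ^ (-θ) / θ).toNNReal, fun U u hu t ht => ?_⟩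
  refine (realInterpENorm_le_below_add ι _ _ hT (u t)).trans ?_
  rw [eLpNorm_one_rpow_neg_Ioi hθ0 hT, ENNReal.coe_add, ENNReal.coe_mul, add_mul,
    mul_right_comm (C : ℝ≥0∞)]
  refine add_le_add ((hu.realInterpENormBelow_one_le hθ.2 ht ⟨hT.le, le_rfl⟩).trans_eq ?_) ?_
  · rw [← ofReal_norm U]
    change _ = ENNReal.ofReal _ * _
    rw [← ENNReal.ofReal_mul (by positivity)]
    congr 1
    ring
  · exact mul_le_mul' (hC U u hu t ht) le_rfl

/-- The cut is at d = |t - t'|, where both parts scale like d^(1 - 1/s - θ). In the constant, the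
first term counts the two points t and t' below d, and 2/θ comes from the Hölder bound in X above d.
-/
theorem IsRep.exists_realInterpENorm_one_sub_le {θ : ℝ} (hθ : θ ∈ Ioo 0 (1 - 1 / s)) :
    ∃ C : ℝ≥0, ∀ (U : MaxRegSpace ι (ENNReal.ofReal s) T) (u : ℝ → X), IsRep U u →
      ∀ t ∈ Icc 0 T, ∀ t' ∈ Icc 0 T, realInterpENorm ι θ 1 (u t - u t') ≤
        C * ‖U‖ₑ * ENNReal.ofReal (|t - t'| ^ (1 - 1 / s - θ)) := by
  have hβ : 0 < 1 - 1 / s - θ := sub_pos.2 hθ.2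
  have hθ0 := hθ.1
  refine ⟨(2 * (2 * 2 ^ (1 - 1 / s) / (1 - 1 / s - θ)) + 2 / θ).toNNReal,
    fun U u hu t ht t' ht' => ?_⟩
  -- The cut needs d > 0.
  rcases eq_or_ne t t' with rfl | hne
  · have h := realInterpENorm_smul ι θ 1 (0 : 𝕜) 0
    simp only [zero_smul, enorm_zero, zero_mul] at h
    rw [sub_self, h]
    exact zero_le
  set d := |t - t'| with hd
  have hd0 : 0 < d := abs_pos.2 (sub_ne_zero.2 hne)
  have hdT : d ∈ Icc 0 T := by
    refine ⟨hd0.le, abs_le.2 ?_⟩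
    constructor <;> linarith [ht.1, ht.2, ht'.1, ht'.2]
  have h1 := (realInterpENormBelow_sub_le ι θ 1 d (u t) (u t')).trans
    (add_le_add (hu.realInterpENormBelow_one_le hθ.2 ht hdT)
      (hu.realInterpENormBelow_one_le hθ.2 ht' hdT))
  have h2 := hu.enorm_sub_le ht ht'
  rw [← hd, ← ofReal_norm U, ENNReal.ofReal_rpow_of_nonneg hd0.le (one_sub_one_div_pos s).le,
    ← ENNReal.ofReal_ofNat, ← ENNReal.ofReal_mul (by positivity),
    ← ENNReal.ofReal_mul (by positivity)] at h2
  refine (realInterpENorm_le_below_add ι _ _ hd0 _).trans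
    ((add_le_add h1 (mul_le_mul' h2 le_rfl)).trans_eq ?_)
  rw [eLpNorm_one_rpow_neg_Ioi hθ0 hd0, ← ofReal_norm U]
  change _ = ENNReal.ofReal _ * _ * _
  rw [← ENNReal.ofReal_add (by positivity) (by positivity), ← ENNReal.ofReal_mul (by positivity),
    ← ENNReal.ofReal_add (by positivity) (by positivity), ← ENNReal.ofReal_mul (by positivity),
    ← ENNReal.ofReal_mul (by positivity)]
  congr 1
  rw [Real.rpow_sub hd0, Real.rpow_neg hd0.le]
  field_simp
  ring

end MaxRegSpace

end Embedding

/-! ### Families of linear maps as operators into function spaces -/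

section OperatorsIntoFunctionSpaces

variable {𝕜 V Z : Type*} [RCLike 𝕜] [AddCommMonoid V] [Module 𝕜 V]
  [NormedAddCommGroup Z] [NormedSpace 𝕜 Z]

theorem exists_linearMap_continuousMap {A : Type*} [TopologicalSpace A] [CompactSpace A]
    (f : A → V →ₗ[𝕜] Z) (hf : ∀ U, Continuous fun t => f t U) {N : V → ℝ≥0}
    (h : ∀ U t, ‖f t U‖ ≤ N U) :
    ∃ E : V →ₗ[𝕜] C(A, Z), (∀ U t, E U t = f t U) ∧ ∀ U, ‖E U‖ ≤ N U :=
  ⟨{  toFun := fun U => ⟨fun t => f t U, hf U⟩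
      map_add' := fun U U' => ContinuousMap.ext fun t => map_add (f t) U U'
      map_smul' := fun c U => ContinuousMap.ext fun t => map_smul (f t) c U },
    fun _ _ => rfl, fun U => (ContinuousMap.norm_le _ (N U).2).2 fun t => h U t⟩

theorem exists_linearMap_hoelderSpace {A : Type*} [MetricSpace A] {β : ℝ≥0} (hβ : 0 < β)
    (f : A → V →ₗ[𝕜] Z) {N M : V → ℝ≥0} (h : ∀ U t, ‖f t U‖ ≤ N U)
    (hf : ∀ U, HolderWith (M U) β fun t => f t U) :
    ∃ E : V →ₗ[𝕜] HoelderSpace 𝕜 A β Z,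
      (∀ U t, HoelderSpace.toBCF 𝕜 A β Z (E U) t = f t U) ∧ ∀ U, ‖E U‖ ≤ N U + M U := by
  let F (U : V) : HoelderSpace 𝕜 A β Z :=
    ⟨BoundedContinuousFunction.ofNormedAddCommGroup (fun t => f t U) ((hf U).continuous hβ)
      (N U) (h U), (hf U).memHolder⟩
  have hF : ∀ U t, HoelderSpace.toBCF 𝕜 A β Z (F U) t = f t U := fun _ _ => rfl
  refine ⟨{ toFun := F, map_add' := fun U U' => ?_, map_smul' := fun c U => ?_ }, hF, fun U => ?_⟩
  · refine HoelderSpace.toBCF_injective 𝕜 A β Z (BoundedContinuousFunction.ext fun t => ?_)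
    rw [map_add, BoundedContinuousFunction.add_apply, hF, hF, hF, map_add]
  · refine HoelderSpace.toBCF_injective 𝕜 A β Z (BoundedContinuousFunction.ext fun t => ?_)
    rw [map_smul, BoundedContinuousFunction.smul_apply, hF, hF, map_smul, RingHom.id_apply]
  · rw [HoelderSpace.norm_def]
    refine add_le_add ?_ ?_
    · exact BoundedContinuousFunction.norm_ofNormedAddCommGroup_le _ (N U).2 (h U)
    · exact_mod_cast (hf U).nnholderNorm_le

theorem injective_of_forall_map_eq_zero (f : V →ₗ[𝕜] Z) (h : ∀ U, f U = 0 → U = 0) :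
    Function.Injective f := fun U U' hU => by
  -- `V` is only an additive monoid here, so (-1) • U' takes the place of the negative of U'.
  have h1 : U + (-1 : 𝕜) • U' = 0 := h _ (by rw [f.map_add, f.map_smul, hU, neg_one_smul,
    add_neg_cancel])
  have h2 : (-1 : 𝕜) • U' + U' = 0 := by
    nth_rw 2 [← one_smul 𝕜 U']
    rw [← add_smul, neg_add_cancel, zero_smul]
  rw [← add_zero U, ← h2, ← add_assoc, h1, zero_add]

end OperatorsIntoFunctionSpaces

/-! ### Evaluation of the representative and the two embeddings -/

section Trace

variable {𝕜 X Y : Type*} [RCLike 𝕜] [NormedAddCommGroup X] [NormedSpace 𝕜 X]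
  [NormedAddCommGroup Y] [NormedSpace 𝕜 Y] [NormedSpace ℝ X] [IsScalarTower ℝ 𝕜 X]

namespace MaxRegSpace

variable {ι : Y →L[𝕜] X} {T s : ℝ} [hs : Fact (1 < s)]

theorem exists_clm_injective {Z : Type*} [NormedAddCommGroup Z] [NormedSpace 𝕜 Z]
    (f : MaxRegSpace ι (ENNReal.ofReal s) T →ₗ[𝕜] Z) (C : ℝ) (h : ∀ U, ‖f U‖ ≤ C * ‖U‖)
    (h0 : ∀ U, f U = 0 → U = 0) :
    ∃ E : MaxRegSpace ι (ENNReal.ofReal s) T →L[𝕜] Z, Function.Injective E ∧ ∀ U, E U = f U :=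
  ⟨⟨f, AddMonoidHomClass.continuous_of_bound f C h⟩,
    injective_of_forall_map_eq_zero f h0, fun _ => rfl⟩

variable [CompleteSpace X]

/-- The continuous representative of an element of `W^{1,p}(J; X) ∩ L^p(J; Y)`. -/
noncomputable def rep (hT : 0 < T) (U : MaxRegSpace ι (ENNReal.ofReal s) T) : ℝ → X :=
  (exists_isRep hT U).choose

theorem isRep_rep (hT : 0 < T) (U : MaxRegSpace ι (ENNReal.ofReal s) T) : IsRep U (rep hT U) :=
  (exists_isRep hT U).choose_spec

/-- Evaluation of the continuous representative, with values in a real interpolation space. -/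
noncomputable def trace (hT : 0 < T) (θ : ℝ) (q : ℝ≥0∞) [Fact (1 ≤ q)]
    (hmem : ∀ (U : MaxRegSpace ι (ENNReal.ofReal s) T), ∀ t ∈ Icc 0 T,
      realInterpENorm ι θ q (rep hT U t) < ⊤)
    (t : Icc (0 : ℝ) T) : MaxRegSpace ι (ENNReal.ofReal s) T →ₗ[𝕜] RealInterp ι θ q :=
  LinearMap.codRestrict (realInterpSubmodule ι θ q)
    { toFun := fun U => rep hT U t
      map_add' := fun U U' =>
        (isRep_rep hT (U + U')).eqOn hT ((isRep_rep hT U).add (isRep_rep hT U')) t.2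
      map_smul' := fun c U => (isRep_rep hT (c • U)).eqOn hT ((isRep_rep hT U).smul c) t.2 }
    fun U => hmem U t t.2

variable {hT : 0 < T} {θ : ℝ} {q : ℝ≥0∞} [Fact (1 ≤ q)]
  {hmem : ∀ (U : MaxRegSpace ι (ENNReal.ofReal s) T), ∀ t ∈ Icc 0 T,
    realInterpENorm ι θ q (rep hT U t) < ⊤}

theorem incl_trace (t : Icc (0 : ℝ) T) (U : MaxRegSpace ι (ENNReal.ofReal s) T) :
    RealInterp.incl ι θ q (trace hT θ q hmem t U) = rep hT U t := rfl

theorem enorm_trace (t : Icc (0 : ℝ) T) (U : MaxRegSpace ι (ENNReal.ofReal s) T) :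
    ‖trace hT θ q hmem t U‖ₑ = realInterpENorm ι θ q (rep hT U t) := by
  rw [← ofReal_norm, RealInterp.norm_def, incl_trace, ENNReal.ofReal_toReal (hmem U t t.2).ne]

theorem edist_trace (t t' : Icc (0 : ℝ) T) (U : MaxRegSpace ι (ENNReal.ofReal s) T) :
    edist (trace hT θ q hmem t U) (trace hT θ q hmem t' U) =
      realInterpENorm ι θ q (rep hT U t - rep hT U t') := by
  rw [edist_eq_enorm_sub, ← ofReal_norm, RealInterp.norm_def, ENNReal.ofReal_toReal
    (RealInterp.enorm_incl_lt_top ι θ q _).ne, map_sub, incl_trace, incl_trace]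

theorem norm_trace_le {C : ℝ≥0} {t : Icc (0 : ℝ) T} {U : MaxRegSpace ι (ENNReal.ofReal s) T}
    (h : realInterpENorm ι θ q (rep hT U t) ≤ C * ‖U‖ₑ) : ‖trace hT θ q hmem t U‖ ≤ C * ‖U‖ := by
  rw [← enorm_trace (hmem := hmem), enorm_eq_nnnorm, enorm_eq_nnnorm] at h
  have h' : ‖trace hT θ q hmem t U‖₊ ≤ C * ‖U‖₊ := by exact_mod_cast h
  exact_mod_cast h'

theorem ae_incl_trace_eq (U : MaxRegSpace ι (ENNReal.ofReal s) T) :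
    ∀ᵐ t : ℝ, ∀ ht : t ∈ Ioo 0 T,
      RealInterp.incl ι θ q (trace hT θ q hmem ⟨t, Ioo_subset_Icc_self ht⟩ U) = toLp U t := by
  filter_upwards [(ae_restrict_iff' measurableSet_Ioo).1 (isRep_rep hT U).ae_eq] with t h ht
  exact h ht

/-- Injectivity of both embeddings: values on the open interval suffice, so it serves the closed
interval in (a) and the open one in (b). -/
theorem eq_zero_of_trace_eq_zero (hι : Function.Injective ι)
    {U : MaxRegSpace ι (ENNReal.ofReal s) T}
    (h : ∀ t (ht : t ∈ Ioo 0 T), trace hT θ q hmem ⟨t, Ioo_subset_Icc_self ht⟩ U = 0) : U = 0 := by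
  refine eq_zero_of_ae_eq_zero hι ((ae_restrict_iff' measurableSet_Ioo).2 ?_)
  filter_upwards [ae_incl_trace_eq (hT := hT) (hmem := hmem) U] with t h' ht
  rw [← h' ht, h t ht, map_zero]
  rfl

end MaxRegSpace

namespace MaxRegSpace

variable {ι : Y →L[𝕜] X} {T s : ℝ} [hs : Fact (1 < s)] [CompleteSpace X]

/-- The embedding of `W^{1,p}(J; X) ∩ L^p(J; Y)` into the continuous functions with values in the
trace space `(X, Y)_{1 - 1/p, p}`. -/
theorem exists_continuousMap_embedding [CompleteSpace Y] (hι : Function.Injective ι)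
    (hT : 0 < T) :
    ∃ E : MaxRegSpace ι (ENNReal.ofReal s) T →L[𝕜]
        C(Icc (0 : ℝ) T, RealInterp ι (1 - 1 / s) (ENNReal.ofReal s)),
      Function.Injective E ∧
      ∀ u : MaxRegSpace ι (ENNReal.ofReal s) T, ∀ᵐ t : ℝ, ∀ ht : t ∈ Ioo 0 T,
        RealInterp.incl ι (1 - 1 / s) (ENNReal.ofReal s) (E u ⟨t, Ioo_subset_Icc_self ht⟩) =
          toLp u t := by
  obtain ⟨C, hC⟩ := IsRep.exists_realInterpENorm_le (ι := ι) (s := s) hT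
  have hmem : ∀ (U : MaxRegSpace ι (ENNReal.ofReal s) T), ∀ t ∈ Icc 0 T,
      realInterpENorm ι (1 - 1 / s) (ENNReal.ofReal s) (rep hT U t) < ⊤ := fun U t ht =>
    (hC U _ (isRep_rep hT U) t ht).trans_lt (by finiteness)
  have hcont : ∀ U : MaxRegSpace ι (ENNReal.ofReal s) T,
      Continuous fun t => trace hT _ _ hmem t U := by
    refine fun U => EMetric.continuous_iff.2 fun t η hη => ?_
    obtain ⟨η', hη', hlt⟩ := exists_between hη
    obtain ⟨δ, hδ, h⟩ := (isRep_rep hT U).exists_realInterpENorm_sub_le hT hη'.ne'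
    refine ⟨ENNReal.ofReal δ, ENNReal.ofReal_pos.2 hδ, fun t' ht' => ?_⟩
    rw [edist_trace]
    refine (h t' t'.2 t t.2 ?_).trans_lt hlt
    rwa [edist_lt_ofReal, Subtype.dist_eq, Real.dist_eq] at ht'
  obtain ⟨E, hE, hbound⟩ := exists_linearMap_continuousMap (fun t => trace hT _ _ hmem t) hcont
    (N := fun U => C * ‖U‖₊) fun U t => norm_trace_le (hC U _ (isRep_rep hT U) t t.2)
  obtain ⟨E', hinj, hE'⟩ := exists_clm_injective E C hbound fun U hU =>
    eq_zero_of_trace_eq_zero (hT := hT) (hmem := hmem) hι fun t ht => by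
      rw [← hE, hU, ContinuousMap.zero_apply]
  refine ⟨E', hinj, fun U => ?_⟩
  filter_upwards [ae_incl_trace_eq (hT := hT) (hmem := hmem) U] with t h ht
  rw [hE', hE, h ht]

/-- The embedding of `W^{1,p}(J; X) ∩ L^p(J; Y)` into Hölder spaces. -/
theorem exists_hoelderSpace_embedding [CompleteSpace Y] (hι : Function.Injective ι)
    (hT : 0 < T) {θ : ℝ} {β : ℝ≥0}
    (hθ : θ ∈ Ioo 0 (1 - 1 / s)) (hβ : (β : ℝ) = 1 - 1 / s - θ) :
      ∃ E : MaxRegSpace ι (ENNReal.ofReal s) T →L[𝕜]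
          HoelderSpace 𝕜 (Ioo (0 : ℝ) T) β (RealInterp ι θ 1),
        Function.Injective E ∧
        ∀ u : MaxRegSpace ι (ENNReal.ofReal s) T, ∀ᵐ t : ℝ, ∀ ht : t ∈ Ioo 0 T,
          RealInterp.incl ι θ 1
              (HoelderSpace.toBCF 𝕜 (Ioo (0 : ℝ) T) β (RealInterp ι θ 1) (E u) ⟨t, ht⟩) =
            toLp u t := by
  obtain ⟨C, hC⟩ := IsRep.exists_realInterpENorm_one_le (ι := ι) (s := s) hT hθ
  obtain ⟨D, hD⟩ := IsRep.exists_realInterpENorm_one_sub_le (ι := ι) (s := s) (T := T) hθ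
  have hβ0 : 0 < β := by
    have : (0 : ℝ) < β := by rw [hβ]; exact sub_pos.2 hθ.2
    exact_mod_cast this
  have hmem : ∀ (U : MaxRegSpace ι (ENNReal.ofReal s) T), ∀ t ∈ Icc 0 T,
      realInterpENorm ι θ 1 (rep hT U t) < ⊤ := fun U t ht =>
    (hC U _ (isRep_rep hT U) t ht).trans_lt (by finiteness)
  have hhol : ∀ U : MaxRegSpace ι (ENNReal.ofReal s) T, HolderWith (D * ‖U‖₊) β
      fun t : Ioo 0 T => trace hT θ 1 hmem ⟨t, Ioo_subset_Icc_self t.2⟩ U := by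
    intro U t t'
    rw [edist_trace, edist_dist, Subtype.dist_eq, Real.dist_eq,
      ENNReal.ofReal_rpow_of_nonneg (abs_nonneg _) β.coe_nonneg, hβ]
    exact hD U _ (isRep_rep hT U) t (Ioo_subset_Icc_self t.2) t' (Ioo_subset_Icc_self t'.2)
  obtain ⟨E, hE, hbound⟩ := exists_linearMap_hoelderSpace hβ0
    (fun t : Ioo 0 T => trace hT θ 1 hmem ⟨t, Ioo_subset_Icc_self t.2⟩)
    (N := fun U => C * ‖U‖₊)
    (fun U t => norm_trace_le (hC U _ (isRep_rep hT U) t (Ioo_subset_Icc_self t.2))) hhol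
  obtain ⟨E', hinj, hE'⟩ := exists_clm_injective E (C + D)
    (fun U => (hbound U).trans_eq (add_mul _ _ _).symm) fun U hU =>
    eq_zero_of_trace_eq_zero (hT := hT) (hmem := hmem) hι fun t ht => by
      rw [← hE U ⟨t, ht⟩, hU, map_zero, BoundedContinuousFunction.coe_zero, Pi.zero_apply]
  refine ⟨E', hinj, fun U => ?_⟩
  filter_upwards [ae_incl_trace_eq (hT := hT) (hmem := hmem) U] with t h ht
  rw [hE', hE, h ht]

end MaxRegSpace

end Trace

theorem lemma3p4 {𝕜 X Y : Type*} [RCLike 𝕜]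
    [NormedAddCommGroup X] [NormedSpace 𝕜 X] [NormedSpace ℝ X] [IsScalarTower ℝ 𝕜 X]
    [CompleteSpace X] [NormedAddCommGroup Y] [NormedSpace 𝕜 Y] [CompleteSpace Y]
    (ι : Y →L[𝕜] X) (hι : Function.Injective ι) (T : ℝ) (hT : 0 < T)
    (s : ℝ) [hs : Fact (1 < s)] :
    (∃ E : MaxRegSpace ι (ENNReal.ofReal s) T →L[𝕜]
        C(Icc (0 : ℝ) T, RealInterp ι (1 - 1 / s) (ENNReal.ofReal s)),
      Function.Injective E ∧
      ∀ u : MaxRegSpace ι (ENNReal.ofReal s) T, ∀ᵐ t : ℝ, ∀ ht : t ∈ Ioo 0 T,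
        RealInterp.incl ι (1 - 1 / s) (ENNReal.ofReal s) (E u ⟨t, Ioo_subset_Icc_self ht⟩) =
          MaxRegSpace.toLp u t) ∧
    (∀ (θ : ℝ) (β : ℝ≥0), θ ∈ Ioo 0 (1 - 1 / s) → (β : ℝ) = 1 - 1 / s - θ →
      ∃ E : MaxRegSpace ι (ENNReal.ofReal s) T →L[𝕜]
          HoelderSpace 𝕜 (Ioo (0 : ℝ) T) β (RealInterp ι θ 1),
        Function.Injective E ∧
        ∀ u : MaxRegSpace ι (ENNReal.ofReal s) T, ∀ᵐ t : ℝ, ∀ ht : t ∈ Ioo 0 T,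
          RealInterp.incl ι θ 1
              (HoelderSpace.toBCF 𝕜 (Ioo (0 : ℝ) T) β (RealInterp ι θ 1) (E u) ⟨t, ht⟩) =
            MaxRegSpace.toLp u t) :=
  ⟨MaxRegSpace.exists_continuousMap_embedding hι hT, fun _ _ hθ hβ =>
    MaxRegSpace.exists_hoelderSpace_embedding hι hT hθ hβ⟩
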